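/- Let $d\ge 1$ and let $X=\ell_p(\mathbb N)$ with $1\le p<\infty$, or $X=c_0(\mathbb N)$ (complex sequences $(x_n)_{n\ge 0}$, with the usual norm). For a sequence $v=(v_n)_{n\ge1}$ of positive real numbers let $B_v(x_0,x_1,x_2,\dots)=(v_1x_1,v_2x_2,\dots)$; $v$ is called admissible if $B_v$ maps $X$ into $X$ continuously. Let $I\subset(0,+\infty)$ be $\sigma$-compact and let $(w(a))_{a\in I}$ be a continuous family of admissible weights, i.e. each $w(a)=(w_n(a))_{n\ge1}$ is admissible, each map $a\mapsto w_n(a)$ is continuous on $I$, and $(a,x)\mapsto B_{w(a)}x$ is continuous from $I\times X$ to $X$. Assume that for every compact $I_0\subset I$ there exist $D_1,D_2,\gamma>0$ and $N\ge0$ such that, for all $n\ge N$, - the map $a\in I_0\mapsto\sum_{i=1}^n\log w_i(a)$ is $D_1\log(n)$-Lipschitz; - $w_1(a)\cdots w_n(a)\ge D_2n^\gamma$ for all $a\in I_0$. Then the family $\big(B_{w(\lambda_1)}\times\cdots\times B_{w(\lambda_d)}\big)_{\lambda\in I^d}$ of operators on $X^d$ has a common hypercyclic algebra for the coordinatewise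 product: there is a linear subspace $A\ne\{0\}$ of $X^d$, closed under the coordinatewise product, such that for every $x\in A\setminus\{0\}$ and every $\lambda\in I^d$ the orbit $\{(B_{w(\lambda_1)}\times\cdots\times B_{w(\lambda_d)})^n x: n\ge1\}$ is dense in $X^d$. Moreover, with $I=(0,+\infty)$, the families $w_n(a)=1+\frac an$ and $w_n(a)=\left(1+\frac1n\right)^a$ satisfy these assumptions on each of these spaces $X$, and so have a common hypercyclic algebra for every $d\geq 1$. -/

import Mathlib

open scoped ENNReal ZeroAtInfty

noncomputable section

/-- The space `ℓ_p(ℕ)` of complex sequences. -/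
abbrev EllP (p : ℝ≥0∞) : Type := lp (fun _ : ℕ => ℂ) p

/-- The space `c_0(ℕ)` of complex sequences tending to `0` (`ℕ` carries the discrete topology),
with the supremum norm. -/
abbrev CZero : Type := C₀(ℕ, ℂ)

/-- The inclusion of `ℓ_p(ℕ)` into the space of all complex sequences. -/
def ellPSeq (p : ℝ≥0∞) [Fact (1 ≤ p)] : EllP p →ₗ[ℂ] (ℕ → ℂ) where
  toFun x := fun n => x n
  map_add' _ _ := rfl
  map_smul' _ _ := rfl

/-- The inclusion of `c_0(ℕ)` into the space of all complex sequences. -/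
def cZeroSeq : CZero →ₗ[ℂ] (ℕ → ℂ) where
  toFun x := fun n => x n
  map_add' _ _ := rfl
  map_smul' _ _ := rfl

/-- The backward shift `(x_0, x_1, x_2, …) ↦ (v_1 x_1, v_2 x_2, …)` on the space of all sequences.
The value `v 0` is never used. -/
def seqShift (v : ℕ → ℝ) (x : ℕ → ℂ) : ℕ → ℂ := fun n => (v (n + 1) : ℂ) * x (n + 1)

section Shifts

/- `X` is a space of sequences and `ι` its inclusion into the space of all sequences. -/
variable {X : Type*} [NormedAddCommGroup X] [NormedSpace ℂ X] (ι : X →ₗ[ℂ] (ℕ → ℂ))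

/-- The weighted backward shift `B_v : X → X`: `shift ι v x` is the element of `X` whose sequence
is `(v_1 x_1, v_2 x_2, …)`. It is meaningful when the shift maps `X` into `X`, which is part of
`Admissible`. -/
def shift (v : ℕ → ℝ) : X → X := fun x => Function.invFun ι (seqShift v (ι x))

/-- `v` is an admissible weight sequence on `X`: a sequence `(v_n)_{n ≥ 1}` of positive numbers
whose backward shift maps `X` into `X` and is continuous. -/
structure Admissible (v : ℕ → ℝ) : Prop where
  pos : ∀ n : ℕ, 1 ≤ n → 0 < v n
  maps : ∀ x : X, ∃ y : X, ι y = seqShift v (ι x)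
  cont : Continuous (shift ι v)

/-- `(w(a))_{a ∈ I}` is a continuous family of admissible weights on `X`, that is, all
`a ↦ w_n(a)`, `n ≥ 1`, and `(a, x) ↦ B_{w(a)} x` are continuous. -/
structure IsContinuousFamily (I : Set ℝ) (w : ℝ → ℕ → ℝ) : Prop where
  admissible : ∀ a ∈ I, Admissible ι (w a)
  cont_weight : ∀ n : ℕ, 1 ≤ n → ContinuousOn (fun a => w a n) I
  cont_shift : ContinuousOn (fun q : ℝ × X => shift ι (w q.1) q.2) (I ×ˢ Set.univ)

/-- The operator `B_{w(l_1)} × ⋯ × B_{w(l_d)}` on `X^d`. -/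
def prodShift {d : ℕ} (w : ℝ → ℕ → ℝ) (l : Fin d → ℝ) : (Fin d → X) → (Fin d → X) :=
  fun x j => shift ι (w (l j)) (x j)

/-- The linear subspace `A` of `X^d` is closed under the coordinatewise product. -/
def IsCoordinatewiseSubalgebra {d : ℕ} (A : Submodule ℂ (Fin d → X)) : Prop :=
  ∀ x ∈ A, ∀ y ∈ A, ∃ z ∈ A, ∀ (j : Fin d) (n : ℕ), ι (z j) n = ι (x j) n * ι (y j) n

end Shifts

/-- `x` is a hypercyclic vector of `T`: its orbit `{T^n x : n ≥ 1}` is dense. -/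
def IsHypercyclicVector {Y : Type*} [TopologicalSpace Y] (T : Y → Y) (x : Y) : Prop :=
  Dense {y : Y | ∃ n : ℕ, 1 ≤ n ∧ T^[n] x = y}

/-- The family `(B_{w(l_1)} × ⋯ × B_{w(l_d)})_{l ∈ I^d}` on `X^d` has a common hypercyclic algebra
for the coordinatewise product: a nontrivial subalgebra of `X^d` all of whose nonzero elements are
hypercyclic for every member of the family. -/
def HasCommonHypercyclicAlgebra {X : Type*} [NormedAddCommGroup X] [NormedSpace ℂ X]
    (ι : X →ₗ[ℂ] (ℕ → ℂ)) (d : ℕ) (I : Set ℝ) (w : ℝ → ℕ → ℝ) : Prop :=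
  ∃ A : Submodule ℂ (Fin d → X), IsCoordinatewiseSubalgebra ι A ∧ A ≠ ⊥ ∧
    ∀ x ∈ A, x ≠ 0 → ∀ l : Fin d → ℝ, (∀ j, l j ∈ I) → IsHypercyclicVector (prodShift ι w l) x

/-- On each compact `K ⊆ I`, for all large `n`, the map `a ↦ ∑_{i ≤ n} log (w_i(a))` is
`D₁ log n`-Lipschitz and `w_1(a) ⋯ w_n(a) ≥ D₂ n ^ γ`. -/
def LogLipschitzGrowth (I : Set ℝ) (w : ℝ → ℕ → ℝ) : Prop :=
  ∀ K : Set ℝ, K ⊆ I → IsCompact K →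
    ∃ D₁ D₂ γ : ℝ, 0 < D₁ ∧ 0 < D₂ ∧ 0 < γ ∧ ∃ N : ℕ, ∀ n : ℕ, N ≤ n →
      (∀ a ∈ K, ∀ b ∈ K,
        |∑ i ∈ Finset.Icc 1 n, Real.log (w a i) - ∑ i ∈ Finset.Icc 1 n, Real.log (w b i)|
          ≤ D₁ * Real.log n * |a - b|) ∧
      (∀ a ∈ K, D₂ * (n : ℝ) ^ γ ≤ ∏ i ∈ Finset.Icc 1 n, w a i)

end

/-!
The common hypercyclic algebra is generated by a single vector `u ∈ X^d`, obtained from the Baire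
category theorem.

The parameter set `I^d` is covered by countably many compact sets `L`, so small that
`log (w_1 ⋯ w_n)` oscillates by at most `(γ / 4) log n` on them (`IsSmallParameterSet`). For such an
`L`, a target `v ∈ X^d` and a power `m`, consider the vectors `u` for which every `l ∈ L` admits an
iterate of the shift at `l` that sends `u ^ m` close to `v` and the next powers of `u` close to `0`
(`powerTransitSet`). This set is open because `L` is compact. If `u` lies in all these sets, then
every nonzero element `∑_{k ≥ m} p_k u^k`, `p_m ≠ 0`, of the algebra generated by `u` is hypercyclic
for every parameter: its iterates inherit from `u ^ m` the approximation of `p_m v`.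

The sets are dense because of `exists_common_block`. Write `W_n(a) = w_1(a) ⋯ w_n(a)`. Since
`log W_n` is `D₁ log n`-Lipschitz, one return time `n` serves a whole cell of parameters of side
about `1 / log n`. With `M = 2 ^ t`, a net of `q = (B t) ^ d` points `c_1, …, c_q` of `L` is fine
enough for all return times `k M ≤ M ^ 2`, `1 ≤ k ≤ q`. The perturbation of a finitely supported
vector is `f = ∑_k f_k`, where `f_k` lives on `[k M, k M + ℓ)` and `f_k ^ m` is the preimage of `v`
under the `k M`-th iterate at `c_k`:

* near `c_k`, the `k M`-th iterate sends `f_k ^ m` close to `v`, and `f_k ^ r`, `r > m`, close to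
  `0`, as `f_k` itself is small;
* the blocks before the `k`-th one are annihilated;
* each later block contributes at most a constant times `M ^ (γ / 2) M ^ (-γ)`: the first factor
  compares `W_n` at two parameters of `L`, and the second is the growth of `W_n` over a gap `M`
  between return times.

As `q` is polylogarithmic in `M`, the errors sum to something small, by the triangle inequality
alone. The argument therefore uses little about `X`: the properties listed in `IsSolidSeqSpace`,
which hold for `ℓ_p`, `p < ∞`, and `c_0`.
-/

/-! ### Growth of the two model families -/

lemma sum_log_one_add_inv (n : ℕ) :
    ∑ i ∈ Finset.Icc 1 n, Real.log (1 + 1 / (i : ℝ)) = Real.log (n + 1) := by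
  induction n with
  | zero => simp
  | succ n ih =>
    rw [Finset.sum_Icc_succ_top (by omega), ih, ← Real.log_mul (by positivity) (by positivity)]
    congr 1
    push_cast
    field_simp

lemma exists_pos_le_of_isCompact {K : Set ℝ} (hK : K ⊆ Set.Ioi 0) (hc : IsCompact K) :
    ∃ g : ℝ, 0 < g ∧ ∀ a ∈ K, g ≤ a := by
  rcases K.eq_empty_or_nonempty with rfl | hne
  · exact ⟨1, one_pos, by simp⟩
  · obtain ⟨g, hg⟩ := hc.exists_isLeast hne
    exact ⟨g, hK hg.1, fun a ha => hg.2 ha⟩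

lemma half_lt_log_natCast {n : ℕ} (hn : 2 ≤ n) : 1 / 2 < Real.log n := by
  have h1 : Real.log 2 ≤ Real.log n := Real.log_le_log (by norm_num) (by exact_mod_cast hn)
  have := Real.log_two_gt_d9
  linarith

lemma rpow_le_prod_one_add_inv_rpow {n : ℕ} (g : ℝ) (hg : 0 ≤ g) :
    (n : ℝ) ^ g ≤ ∏ i ∈ Finset.Icc 1 n, (1 + 1 / (i : ℝ)) ^ g := by
  rw [Real.finsetProd_rpow _ _ (fun i _ => by positivity)]
  refine Real.rpow_le_rpow (by positivity) ?_ hg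
  have h := sum_log_one_add_inv n
  rw [← Real.log_prod (fun i _ => by positivity)] at h
  rw [Real.log_injOn_pos (Set.mem_Ioi.2 (Finset.prod_pos fun i _ => by positivity))
    (Set.mem_Ioi.2 (by positivity)) h]
  linarith

/-- The weights `(1 + 1/n)^a` satisfy `∑_{i ≤ n} log w_i(a) = a log (n + 1)`. -/
lemma logLipschitzGrowth_one_add_inv_rpow :
    LogLipschitzGrowth (Set.Ioi 0) (fun (a : ℝ) (n : ℕ) => (1 + 1 / (n : ℝ)) ^ a) := by
  intro K hK hc
  obtain ⟨g, hg, hgK⟩ := exists_pos_le_of_isCompact hK hc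
  refine ⟨2, 1, g, two_pos, one_pos, hg, 2, fun n hn => ⟨fun a _ b _ => ?_, fun a ha => ?_⟩⟩
  · have h (a : ℝ) : ∑ i ∈ Finset.Icc 1 n, Real.log ((1 + 1 / (i : ℝ)) ^ a)
        = a * Real.log (n + 1) := by
      rw [← sum_log_one_add_inv, Finset.mul_sum]
      exact Finset.sum_congr rfl fun i _ => Real.log_rpow (by positivity) a
    simp only [h]
    rw [← sub_mul, abs_mul, mul_comm]
    have h2 : Real.log (n + 1) ≤ 2 * Real.log n := by
      rw [show (2 : ℝ) * Real.log n = Real.log ((n : ℝ) ^ 2) by rw [Real.log_pow]; norm_num]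
      have : (2 : ℝ) ≤ n := by exact_mod_cast hn
      exact Real.log_le_log (by positivity) (by nlinarith)
    rw [abs_of_nonneg (Real.log_nonneg (by linarith [(Nat.cast_nonneg n : (0 : ℝ) ≤ n)]))]
    gcongr
  · rw [one_mul]
    refine (rpow_le_prod_one_add_inv_rpow g hg.le).trans ?_
    refine Finset.prod_le_prod (fun i _ => by positivity) fun i _ => ?_
    exact Real.rpow_le_rpow_of_exponent_le (by simp) (hgK a ha)

lemma abs_log_one_add_div_sub_le {a b : ℝ} (ha : 0 < a) (hb : 0 < b) {i : ℕ} (hi : 1 ≤ i) :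
    |Real.log (1 + a / i) - Real.log (1 + b / i)| ≤ |a - b| * (i : ℝ)⁻¹ := by
  have hi' : (0 : ℝ) < i := by exact_mod_cast hi
  have key : ∀ {a b : ℝ}, 0 < a → 0 < b →
      Real.log (1 + a / i) - Real.log (1 + b / i) ≤ |a - b| * (i : ℝ)⁻¹ := by
    intro a b ha hb
    rw [← Real.log_div (by positivity) (by positivity)]
    refine (Real.log_le_sub_one_of_pos (by positivity)).trans ?_
    rw [div_sub_one (by positivity), show (1 + a / i - (1 + b / i)) = (a - b) * (i : ℝ)⁻¹ by ring]
    calc (a - b) * (i : ℝ)⁻¹ / (1 + b / i) ≤ |a - b| * (i : ℝ)⁻¹ / (1 + b / i) := by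
          gcongr; exact le_abs_self _
      _ ≤ |a - b| * (i : ℝ)⁻¹ := div_le_self (by positivity)
          (by linarith [show 0 < b / (i : ℝ) by positivity])
  rw [abs_le]
  have := key hb ha
  rw [abs_sub_comm] at this
  exact ⟨by linarith, key ha hb⟩

lemma logLipschitzGrowth_one_add_div :
    LogLipschitzGrowth (Set.Ioi 0) (fun (a : ℝ) (n : ℕ) => 1 + a / (n : ℝ)) := by
  intro K hK hc
  obtain ⟨g, hg, hgK⟩ := exists_pos_le_of_isCompact hK hc
  refine ⟨3, 1, min g 1, three_pos, one_pos, lt_min hg one_pos, 2,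
    fun n hn => ⟨fun a ha b hb => ?_, fun a ha => ?_⟩⟩
  · rw [← Finset.sum_sub_distrib]
    refine (Finset.abs_sum_le_sum_abs _ _).trans ?_
    refine (Finset.sum_le_sum fun i hi =>
      abs_log_one_add_div_sub_le (hK ha) (hK hb) (Finset.mem_Icc.1 hi).1).trans ?_
    have h1 := harmonic_le_one_add_log n
    rw [harmonic_eq_sum_Icc] at h1
    push_cast at h1
    rw [← Finset.mul_sum, mul_comm]
    have h2 := half_lt_log_natCast hn
    gcongr
    linarith
  · rw [one_mul]
    have hg0 : 0 ≤ min g 1 := (lt_min hg one_pos).le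
    refine (rpow_le_prod_one_add_inv_rpow _ hg0).trans ?_
    refine Finset.prod_le_prod (fun i _ => by positivity) fun i hi => ?_
    -- Bernoulli's inequality for exponents in `[0, 1]`
    refine (rpow_one_add_le_one_add_mul_self
      (by linarith [show (0 : ℝ) ≤ 1 / (i : ℝ) by positivity]) hg0 (min_le_right _ _)).trans ?_
    rw [mul_one_div]
    have : min g 1 ≤ a := (min_le_left _ _).trans (hgK a ha)
    exact add_le_add_right (div_le_div_of_nonneg_right this (Nat.cast_nonneg i)) 1

/-! ### Solid sequence spaces -/

/-- A normed space `X` of complex sequences, with inclusion `ι` into the space of all sequences, in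
which finitely supported sequences are dense, the unit vectors have norm at most `1`, coordinates
are contractive, and a sequence dominated by `C` times an injective rearrangement of a subsequence
of `y ∈ X` belongs to `X` with norm at most `C ‖y‖`. -/
structure IsSolidSeqSpace {X : Type*} [NormedAddCommGroup X] [NormedSpace ℂ X]
    (ι : X →ₗ[ℂ] (ℕ → ℂ)) : Prop where
  injective : Function.Injective ι
  norm_coord_le : ∀ (x : X) (n : ℕ), ‖ι x n‖ ≤ ‖x‖
  exists_of_dominated : ∀ (y : X) (z : ℕ → ℂ) (σ : ℕ → ℕ) (C : ℝ), Function.Injective σ → 0 ≤ C →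
    (∀ n, ‖z n‖ ≤ C * ‖ι y (σ n)‖) → ∃ x : X, ι x = z ∧ ‖x‖ ≤ C * ‖y‖
  exists_single : ∀ i : ℕ, ∃ e : X, ι e = Pi.single i 1 ∧ ‖e‖ ≤ 1
  exists_approx : ∀ (x : X) (ε : ℝ), 0 < ε → ∃ y : X, (∃ L, ∀ i, L ≤ i → ι y i = 0) ∧ ‖x - y‖ < ε

lemma isSolidSeqSpace_ellPSeq (p : ℝ≥0∞) [Fact (1 ≤ p)] (hp : p ≠ ∞) :
    IsSolidSeqSpace (ellPSeq p) := by
  have h1 : (1 : ℝ≥0∞) ≤ p := Fact.out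
  have hp0 : p ≠ 0 := (lt_of_lt_of_le one_pos h1).ne'
  have hpr : 0 < p.toReal := ENNReal.toReal_pos hp0 hp
  refine ⟨fun x y h => lp.ext h, fun x n => lp.norm_apply_le_norm hp0 x n, ?_, fun i => ?_, ?_⟩
  · intro y z σ C hσ hC hz
    have hs : Summable fun n => C ^ p.toReal * ‖y (σ n)‖ ^ p.toReal :=
      (((lp.memℓp y).summable hpr).comp_injective hσ).mul_left _
    have hle (n : ℕ) : ‖z n‖ ^ p.toReal ≤ C ^ p.toReal * ‖y (σ n)‖ ^ p.toReal := by
      rw [← Real.mul_rpow hC (norm_nonneg _)]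
      exact Real.rpow_le_rpow (norm_nonneg _) (hz n) hpr.le
    have hzs : Summable fun n => ‖z n‖ ^ p.toReal :=
      Summable.of_nonneg_of_le (fun n => by positivity) hle hs
    refine ⟨⟨z, memℓp_gen hzs⟩, rfl, lp.norm_le_of_tsum_le hpr (by positivity) ?_⟩
    refine (hzs.tsum_le_tsum hle hs).trans ?_
    rw [tsum_mul_left, Real.mul_rpow hC (norm_nonneg _), lp.norm_rpow_eq_tsum hpr]
    exact mul_le_mul_of_nonneg_left (tsum_comp_le_tsum_of_inj ((lp.memℓp y).summable hpr)
      (fun n => by positivity) hσ) (by positivity)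
  · refine ⟨lp.single p i 1, ?_, ?_⟩
    · ext n
      exact congrFun (lp.coeFn_single (E := fun _ : ℕ => ℂ) p i 1) n
    · rw [lp.norm_single (hp0.bot_lt)]
      simp
  · intro x ε hε
    obtain ⟨s, hs⟩ := ((Metric.tendsto_nhds.1 (lp.hasSum_single hp x) ε hε)).exists
    refine ⟨∑ i ∈ s, lp.single p i (x i), ⟨s.sup id + 1, fun i hi => ?_⟩, ?_⟩
    · change (∑ i ∈ s, lp.single p i (x i) : lp (fun _ : ℕ => ℂ) p) i = 0
      rw [lp.coeFn_sum, Finset.sum_apply]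
      refine Finset.sum_eq_zero fun k hk => lp.single_apply_ne (E := fun _ : ℕ => ℂ) p k _ ?_
      have : k ≤ s.sup id := Finset.le_sup (f := id) hk
      omega
    · rwa [dist_comm, dist_eq_norm] at hs

lemma isSolidSeqSpace_cZeroSeq : IsSolidSeqSpace cZeroSeq := by
  have hnorm (x : CZero) {C : ℝ} (hC : 0 ≤ C) (h : ∀ n, ‖x n‖ ≤ C) : ‖x‖ ≤ C := by
    rw [← ZeroAtInftyContinuousMap.norm_toBCF_eq_norm]
    exact (BoundedContinuousFunction.norm_le hC).2 h
  have hcoord (x : CZero) (n : ℕ) : ‖x n‖ ≤ ‖x‖ := by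
    rw [← ZeroAtInftyContinuousMap.norm_toBCF_eq_norm]
    exact BoundedContinuousFunction.norm_coe_le_norm x.toBCF n
  have hlim (x : CZero) : Filter.Tendsto x Filter.cofinite (nhds 0) := by
    rw [← Filter.cocompact_eq_cofinite]
    exact x.zero_at_infty'
  have hmk (z : ℕ → ℂ) (hz : Filter.Tendsto z Filter.cofinite (nhds 0)) :
      ∃ x : CZero, ∀ n, x n = z n :=
    ⟨⟨⟨z, continuous_of_discreteTopology⟩, by rwa [Filter.cocompact_eq_cofinite]⟩, fun _ => rfl⟩
  have hfin (z : ℕ → ℂ) (L : ℕ) (hz : ∀ i, L ≤ i → z i = 0) :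
      Filter.Tendsto z Filter.cofinite (nhds 0) := by
    rw [Nat.cofinite_eq_atTop]
    exact tendsto_const_nhds.congr' (by
      filter_upwards [Filter.eventually_ge_atTop L] with i hi using (hz i hi).symm)
  refine ⟨fun x y h => DFunLike.coe_injective h, hcoord, ?_, fun i => ?_, ?_⟩
  · intro y z σ C hσ hC hz
    obtain ⟨x, hx⟩ := hmk z (by
      refine squeeze_zero_norm hz ?_
      have := ((hlim y).comp hσ.tendsto_cofinite).norm.const_mul C
      rw [norm_zero, mul_zero] at this
      exact this)
    refine ⟨x, funext hx, hnorm x (by positivity) fun n => ?_⟩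
    rw [hx]
    refine (hz n).trans ?_
    gcongr
    exact hcoord _ _
  · obtain ⟨x, hx⟩ := hmk (Pi.single i 1) (hfin _ (i + 1) fun n hn =>
      Pi.single_eq_of_ne (by omega) _)
    refine ⟨x, funext hx, hnorm x zero_le_one fun n => ?_⟩
    rw [hx, Pi.single_apply]
    split_ifs <;> simp
  · intro x ε hε
    have hx := hlim x
    rw [Nat.cofinite_eq_atTop] at hx
    obtain ⟨L, hL⟩ := Filter.eventually_atTop.1 (Metric.tendsto_nhds.1 hx (ε / 2) (half_pos hε))
    obtain ⟨y, hy⟩ := hmk (fun i => if i < L then x i else 0)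
      (hfin _ L fun i hi => by simp [not_lt.2 hi])
    refine ⟨y, ⟨L, fun i hi => (hy i).trans (by simp [not_lt.2 hi])⟩, ?_⟩
    refine lt_of_le_of_lt (hnorm _ (half_pos hε).le fun n => ?_) (half_lt_self hε)
    rw [ZeroAtInftyContinuousMap.sub_apply, hy]
    split_ifs with h
    · rw [sub_self, norm_zero]
      exact (half_pos hε).le
    · have := hL n (not_lt.1 h)
      rw [dist_zero_right] at this
      simpa using this.le

/-! ### Continuous families of weights -/

section
variable {X : Type*} [NormedAddCommGroup X] [NormedSpace ℂ X] {ι : X →ₗ[ℂ] (ℕ → ℂ)}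

lemma apply_shift {v : ℕ → ℝ} (h : ∀ x : X, ∃ y : X, ι y = seqShift v (ι x)) (x : X) :
    ι (shift ι v x) = seqShift v (ι x) :=
  Function.invFun_eq (h x)

namespace IsSolidSeqSpace

lemma norm_le_of_dominated (H : IsSolidSeqSpace ι) {x y : X} {σ : ℕ → ℕ} {C : ℝ}
    (hσ : Function.Injective σ) (hC : 0 ≤ C) (h : ∀ n, ‖ι x n‖ ≤ C * ‖ι y (σ n)‖) :
    ‖x‖ ≤ C * ‖y‖ := by
  obtain ⟨z, hz, hn⟩ := H.exists_of_dominated y (ι x) σ C hσ hC h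
  rwa [H.injective hz] at hn

/-- Weights that are bounded and Lipschitz in the parameter, uniformly in `n` and locally in `a`,
form a continuous family. -/
lemma isContinuousFamily (H : IsSolidSeqSpace ι) {I : Set ℝ} {w : ℝ → ℕ → ℝ}
    (hpos : ∀ a ∈ I, ∀ n, 1 ≤ n → 0 < w a n)
    (hlip : ∀ R : ℝ, ∃ C : ℝ, 0 ≤ C ∧ ∀ a ∈ I, ∀ b ∈ I, a ≤ R → b ≤ R → ∀ n, 1 ≤ n →
      |w a n - w b n| ≤ C * |a - b| ∧ w a n ≤ C) :
    IsContinuousFamily ι I w := by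
  have hsucc : Function.Injective (fun n : ℕ => n + 1) := add_left_injective 1
  have hmaps : ∀ a ∈ I, ∀ x : X, ∃ y : X, ι y = seqShift (w a) (ι x) := by
    intro a ha x
    obtain ⟨C, hC, h⟩ := hlip a
    obtain ⟨y, hy, -⟩ := H.exists_of_dominated x (seqShift (w a) (ι x)) (· + 1) C hsucc hC
      fun n => by
        rw [seqShift, norm_mul, Complex.norm_real, Real.norm_eq_abs,
          abs_of_pos (hpos a ha _ (by omega))]
        gcongr
        exact (h a ha a ha le_rfl le_rfl _ (by omega)).2
    exact ⟨y, hy⟩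
  have hcont : ContinuousOn (fun q : ℝ × X => shift ι (w q.1) q.2) (I ×ˢ Set.univ) := by
    rintro ⟨a, x⟩ ⟨ha, -⟩
    obtain ⟨C, hC, h⟩ := hlip (a + 1)
    rw [ContinuousWithinAt, tendsto_iff_norm_sub_tendsto_zero]
    refine squeeze_zero' (g := fun q : ℝ × X => C * ‖q.2 - x‖ + C * |q.1 - a| * ‖x‖)
      (Filter.Eventually.of_forall fun q => norm_nonneg _) ?_ ?_
    · have hev : ∀ᶠ q : ℝ × X in nhdsWithin (a, x) (I ×ˢ Set.univ), q.1 < a + 1 :=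
        nhdsWithin_le_nhds ((isOpen_lt continuous_fst continuous_const).mem_nhds
          (lt_add_one a : (a, x).1 < a + 1))
      filter_upwards [hev, self_mem_nhdsWithin] with q hq hqI
      have hb : q.1 ∈ I := hqI.1
      obtain ⟨z, hz, hzn⟩ := H.exists_of_dominated (q.2 - x)
        (seqShift (w q.1) (ι (q.2 - x))) (· + 1) C hsucc hC fun n => by
          rw [seqShift, norm_mul, Complex.norm_real, Real.norm_eq_abs,
            abs_of_pos (hpos _ hb _ (by omega))]
          gcongr
          exact (h _ hb _ hb hq.le hq.le _ (by omega)).2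
      have h2 : ‖shift ι (w q.1) q.2 - shift ι (w a) x - z‖ ≤ C * |q.1 - a| * ‖x‖ := by
        refine H.norm_le_of_dominated hsucc (by positivity) fun n => ?_
        rw [map_sub, map_sub, hz, apply_shift (hmaps _ hb), apply_shift (hmaps _ ha)]
        simp only [Pi.sub_apply, seqShift, map_sub]
        rw [show (w q.1 (n + 1) : ℂ) * ι q.2 (n + 1) - (w a (n + 1) : ℂ) * ι x (n + 1)
          - (w q.1 (n + 1) : ℂ) * (ι q.2 (n + 1) - ι x (n + 1))
          = ((w q.1 (n + 1) - w a (n + 1) : ℝ) : ℂ) * ι x (n + 1) by push_cast; ring,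
          norm_mul, Complex.norm_real, Real.norm_eq_abs]
        gcongr
        exact (h _ hb _ ha hq.le (by linarith) _ (by omega)).1
      calc ‖shift ι (w q.1) q.2 - shift ι (w a) x‖
          = ‖z + (shift ι (w q.1) q.2 - shift ι (w a) x - z)‖ := by congr 1; abel
        _ ≤ ‖z‖ + ‖shift ι (w q.1) q.2 - shift ι (w a) x - z‖ := norm_add_le _ _
        _ ≤ _ := add_le_add hzn h2
    · have : Continuous fun q : ℝ × X => C * ‖q.2 - x‖ + C * |q.1 - a| * ‖x‖ := by fun_prop
      have h0 := (this.tendsto (a, x)).mono_left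
        (nhdsWithin_le_nhds (s := I ×ˢ (Set.univ : Set X)))
      simpa using h0
  refine ⟨fun a ha => ⟨hpos a ha, hmaps a ha, ?_⟩, fun n hn => ?_, hcont⟩
  · rw [← continuousOn_univ]
    exact hcont.comp (f := fun x : X => (a, x)) (by fun_prop) fun x _ => ⟨ha, trivial⟩
  · intro a ha
    obtain ⟨C, hC, h⟩ := hlip (a + 1)
    rw [ContinuousWithinAt, tendsto_iff_norm_sub_tendsto_zero]
    refine squeeze_zero' (g := fun b : ℝ => C * |b - a|)
      (Filter.Eventually.of_forall fun q => norm_nonneg _) ?_ ?_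
    · filter_upwards [nhdsWithin_le_nhds (Iio_mem_nhds (lt_add_one a)), self_mem_nhdsWithin]
        with b hb hbI
      exact (h b hbI a ha (le_of_lt hb) (by linarith) n hn).1
    · have : Continuous fun b : ℝ => C * |b - a| := by fun_prop
      have h0 := (this.tendsto a).mono_left (nhdsWithin_le_nhds (s := I))
      simpa using h0

lemma isContinuousFamily_one_add_div (H : IsSolidSeqSpace ι) :
    IsContinuousFamily ι (Set.Ioi 0) (fun (a : ℝ) (n : ℕ) => 1 + a / (n : ℝ)) := by
  refine H.isContinuousFamily (fun a (ha : 0 < a) n hn => by positivity) fun R =>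
    ⟨1 + |R|, by positivity, fun a (ha : 0 < a) b (hb : 0 < b) haR hbR n hn => ⟨?_, ?_⟩⟩
  · have hn' : (1 : ℝ) ≤ n := by exact_mod_cast hn
    rw [show 1 + a / (n : ℝ) - (1 + b / n) = (a - b) / n by ring, abs_div, Nat.abs_cast]
    refine (div_le_self (abs_nonneg _) hn').trans ?_
    nlinarith [abs_nonneg (a - b), abs_nonneg R]
  · have hn' : (1 : ℝ) ≤ n := by exact_mod_cast hn
    linarith [div_le_self ha.le hn', le_abs_self R]

lemma isContinuousFamily_one_add_inv_rpow (H : IsSolidSeqSpace ι) :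
    IsContinuousFamily ι (Set.Ioi 0) (fun (a : ℝ) (n : ℕ) => (1 + 1 / (n : ℝ)) ^ a) := by
  have key : ∀ {R a b s : ℝ}, a ≤ R → b ≤ R → 0 ≤ s → s ≤ 1 → b ≤ a → 0 ≤ a →
      |Real.exp (s * a) - Real.exp (s * b)| ≤ Real.exp |R| * |a - b| := by
    intro R a b s ha hb hs hs1 hab ha0
    have h1 : Real.exp (s * b) ≤ Real.exp (s * a) := Real.exp_le_exp.2 (by gcongr)
    rw [abs_of_nonneg (sub_nonneg.2 h1), abs_of_nonneg (sub_nonneg.2 hab)]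
    have h2 : 1 - Real.exp (s * b - s * a) ≤ a - b := by
      have := Real.add_one_le_exp (s * b - s * a)
      nlinarith
    have h3 : Real.exp (s * a) ≤ Real.exp |R| :=
      Real.exp_le_exp.2 (by nlinarith [le_abs_self R])
    have h4 : Real.exp (s * b) = Real.exp (s * a) * Real.exp (s * b - s * a) := by
      rw [← Real.exp_add]; congr 1; ring
    calc Real.exp (s * a) - Real.exp (s * b)
        = Real.exp (s * a) * (1 - Real.exp (s * b - s * a)) := by rw [h4]; ring
      _ ≤ Real.exp (s * a) * (a - b) := by gcongr
      _ ≤ _ := mul_le_mul_of_nonneg_right h3 (sub_nonneg.2 hab)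
  refine H.isContinuousFamily (fun a ha n hn => by positivity) fun R =>
    ⟨Real.exp |R|, by positivity, fun a (ha : 0 < a) b (hb : 0 < b) haR hbR n hn => ?_⟩
  have hn' : (1 : ℝ) ≤ n := by exact_mod_cast hn
  have hpos : (0 : ℝ) < 1 + 1 / n := by positivity
  have hs : 0 ≤ Real.log (1 + 1 / n) := Real.log_nonneg (by simp)
  have hs1 : Real.log (1 + 1 / n) ≤ 1 := by
    have := Real.log_le_sub_one_of_pos hpos
    have h2 : 1 / (n : ℝ) ≤ 1 := div_le_one_of_le₀ hn' (by positivity)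
    linarith
  simp only [Real.rpow_def_of_pos hpos]
  refine ⟨?_, Real.exp_le_exp.2 (by nlinarith [le_abs_self R])⟩
  rcases le_total b a with h | h
  · exact key haR hbR hs hs1 h ha.le
  · rw [abs_sub_comm, abs_sub_comm a b]
    exact key hbR haR hs hs1 h hb.le

end IsSolidSeqSpace
end

/-! ### Nets of parameters and choice of scale -/

/-- A bounded subset of `ℝ^d` has, for each `Q`, a net of `Q ^ d` of its points at scale `R / Q`. -/
lemma exists_net {d : ℕ} {L : Set (Fin d → ℝ)} (hne : L.Nonempty) (hb : Bornology.IsBounded L) :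
    ∃ R : ℝ, 0 < R ∧ ∀ Q : ℕ, 1 ≤ Q → ∃ c : ℕ → Fin d → ℝ, (∀ k, c k ∈ L) ∧
      ∀ l ∈ L, ∃ k, 1 ≤ k ∧ k ≤ Q ^ d ∧ ∀ j, |l j - c k j| ≤ R / Q := by
  classical
  obtain ⟨x₀, hx₀⟩ := hne
  obtain ⟨C, hC⟩ := hb.exists_norm_le
  have hC0 : 0 ≤ C := (norm_nonneg _).trans (hC _ hx₀)
  set r := C + 1 with hr
  have hr0 : 0 < r := by linarith
  have hlt : ∀ l ∈ L, ∀ j, 0 ≤ l j + r ∧ l j + r < 2 * r := by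
    intro l hl j
    have h1 := (norm_le_pi_norm l j).trans (hC l hl)
    rw [Real.norm_eq_abs, abs_le] at h1
    constructor <;> linarith
  refine ⟨2 * r, by positivity, fun Q hQ => ?_⟩
  have hQ0 : (0 : ℝ) < Q := by exact_mod_cast hQ
  -- `cell l j` is the index of the interval of length `2 r / Q` containing `l j`
  let cell : (Fin d → ℝ) → Fin d → ℕ := fun l j => ⌊(l j + r) * (Q / (2 * r))⌋₊
  have hcell : ∀ l ∈ L, ∀ j, cell l j < Q := by
    intro l hl j
    rw [Nat.floor_lt (mul_nonneg (hlt l hl j).1 (by positivity))]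
    calc (l j + r) * (Q / (2 * r)) < 2 * r * (Q / (2 * r)) := by
          gcongr; exact (hlt l hl j).2
      _ = Q := by field_simp
  have hclose : ∀ l ∈ L, ∀ l' ∈ L, cell l = cell l' → ∀ j, |l j - l' j| ≤ 2 * r / Q := by
    intro l hl l' hl' h j
    have h0 : cell l j = cell l' j := congrFun h j
    have h1 : |(l j + r) * (Q / (2 * r)) - (l' j + r) * (Q / (2 * r))| < 1 := by
      have e1 := Nat.floor_le (mul_nonneg (hlt l hl j).1 (by positivity : 0 ≤ (Q : ℝ) / (2 * r)))
      have e2 := Nat.floor_le (mul_nonneg (hlt l' hl' j).1 (by positivity : 0 ≤ (Q : ℝ) / (2 * r)))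
      have e3 := Nat.lt_floor_add_one ((l j + r) * (Q / (2 * r)))
      have e4 := Nat.lt_floor_add_one ((l' j + r) * (Q / (2 * r)))
      change (cell l j : ℝ) ≤ _ at e1
      change (cell l' j : ℝ) ≤ _ at e2
      change _ < (cell l j : ℝ) + 1 at e3
      change _ < (cell l' j : ℝ) + 1 at e4
      rw [h0] at e1 e3
      rw [abs_lt]
      constructor <;> linarith
    rw [← sub_mul, abs_mul, abs_of_pos (by positivity : 0 < (Q : ℝ) / (2 * r)),
      show l j + r - (l' j + r) = l j - l' j by ring] at h1
    rw [le_div_iff₀ hQ0]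
    have h2 : |l j - l' j| * (Q / (2 * r)) * (2 * r) ≤ 1 * (2 * r) := by gcongr
    rwa [mul_assoc, div_mul_cancel₀ _ (by positivity), one_mul] at h2
  have hg : ∀ τ : Fin d → Fin Q, ∃ g ∈ L, ∀ l ∈ L, (∀ j, cell l j = τ j) →
      ∀ j, |l j - g j| ≤ 2 * r / Q := by
    intro τ
    by_cases h : ∃ g ∈ L, ∀ j, cell g j = τ j
    · obtain ⟨g, hgL, hg⟩ := h
      exact ⟨g, hgL, fun l hl hlτ => hclose l hl g hgL (funext fun j => (hlτ j).trans (hg j).symm)⟩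
    · exact ⟨x₀, hx₀, fun l hl hlτ => absurd ⟨l, hl, hlτ⟩ h⟩
  choose g hgL hg using hg
  refine ⟨fun k => if h : k - 1 < Q ^ d then g (finFunctionFinEquiv.symm ⟨k - 1, h⟩) else x₀,
    fun k => ?_, fun l hl => ?_⟩
  · dsimp only
    split_ifs
    exacts [hgL _, hx₀]
  · let τ : Fin d → Fin Q := fun j => ⟨cell l j, hcell l hl j⟩
    refine ⟨finFunctionFinEquiv τ + 1, by omega, (finFunctionFinEquiv τ).2, fun j => ?_⟩
    have h : (finFunctionFinEquiv τ : ℕ) + 1 - 1 < Q ^ d := by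
      rw [Nat.add_sub_cancel]; exact (finFunctionFinEquiv τ).2
    simp only [dif_pos h]
    have : (⟨(finFunctionFinEquiv τ : ℕ) + 1 - 1, h⟩ : Fin (Q ^ d)) = finFunctionFinEquiv τ := by
      exact Fin.ext (Nat.add_sub_cancel _ _)
    rw [this, Equiv.symm_apply_apply]
    exact hg τ l hl (fun _ => rfl) j

/-- Polynomial factors in `t` are beaten by the powers of `2 ^ t`: this is what allows a number of
return times that is polylogarithmic in their size. -/
lemma eventually_exists_small (A g : ℝ) (hg : 0 < g) (m : ℕ) (hm : 1 ≤ m) (d B : ℕ)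
    {ε : ℝ} (hε : 0 < ε) :
    ∀ᶠ t : ℕ in Filter.atTop, ∃ β : ℝ, 0 ≤ β ∧ β ≤ 1 ∧ (((B * t) ^ d + 1 : ℕ) : ℝ) * β ≤ ε ∧
      A * ((2 ^ t : ℕ) : ℝ) ^ (-g) ≤ β ^ m := by
  have hm0 : (m : ℝ) ≠ 0 := by exact_mod_cast (by omega : m ≠ 0)
  set C := max 1 A
  have hC1 : 1 ≤ C := le_max_left _ _
  set r : ℝ := (2 : ℝ) ^ (-g / m) with hr
  have hr0 : 0 < r := by positivity
  have hr1 : r < 1 := Real.rpow_lt_one_of_one_lt_of_neg (by norm_num)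
    (div_neg_of_neg_of_pos (by linarith) (by positivity))
  have habs : |r| < 1 := by rwa [abs_of_pos hr0]
  have ht1 : Filter.Tendsto (fun t : ℕ => C * r ^ t) Filter.atTop (nhds (C * 0)) :=
    (tendsto_pow_atTop_nhds_zero_of_lt_one hr0.le hr1).const_mul C
  have ht2 : Filter.Tendsto (fun t : ℕ => (B : ℝ) ^ d * C * ((t : ℝ) ^ d * r ^ t) + C * r ^ t)
      Filter.atTop (nhds ((B : ℝ) ^ d * C * 0 + C * 0)) :=
    ((tendsto_pow_const_mul_const_pow_of_abs_lt_one d habs).const_mul _).add ht1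
  rw [mul_zero] at ht1
  rw [mul_zero, mul_zero, add_zero] at ht2
  filter_upwards [ht1.eventually_lt_const one_pos, ht2.eventually_lt_const hε] with t h1 h2
  refine ⟨C * r ^ t, by positivity, h1.le, ?_, ?_⟩
  · refine le_trans (le_of_eq ?_) h2.le
    push_cast
    ring
  · have : ((2 ^ t : ℕ) : ℝ) ^ (-g) = (r ^ t) ^ m := by
      rw [hr]
      push_cast
      rw [← Real.rpow_natCast, ← Real.rpow_natCast, ← Real.rpow_natCast, ← Real.rpow_mul (by norm_num),
        ← Real.rpow_mul (by positivity), ← Real.rpow_mul (by positivity)]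
      congr 1
      field_simp
    rw [this, mul_pow]
    gcongr
    exact (le_max_right 1 A).trans (le_self_pow₀ hC1 (by omega))

lemma eventually_pow_add_one_le_two_pow (d B : ℕ) :
    ∀ᶠ t : ℕ in Filter.atTop, (B * t) ^ d + 1 ≤ 2 ^ t := by
  filter_upwards [eventually_exists_small 1 1 one_pos 1 le_rfl d B one_pos] with t ht
  obtain ⟨β, hβ0, -, h1, h2⟩ := ht
  rw [pow_one, one_mul, Real.rpow_neg_one] at h2
  have hpos : (0 : ℝ) < ((2 ^ t : ℕ) : ℝ) := by positivity
  have h3 : (((B * t) ^ d + 1 : ℕ) : ℝ) * (((2 ^ t : ℕ) : ℝ))⁻¹ ≤ 1 :=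
    (mul_le_mul_of_nonneg_left h2 (by positivity)).trans h1
  rw [← div_eq_mul_inv, div_le_one hpos] at h3
  exact_mod_cast h3

/-- The number of `i < (q + 1) M` with `i % M < ℓ`. -/
lemma card_filter_mod_lt (q M ℓ : ℕ) :
    ((Finset.range ((q + 1) * M)).filter fun i => i % M < ℓ).card ≤ (q + 1) * ℓ := by
  rw [show (q + 1) * ℓ = (Finset.range (q + 1) ×ˢ Finset.range ℓ).card by simp]
  refine Finset.card_le_card_of_injOn (fun i => (i / M, i % M)) (fun i hi => ?_) ?_
  · simp only [Finset.coe_filter, Finset.mem_range, Set.mem_ofPred_eq] at hi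
    simp only [Finset.coe_product, Set.mem_prod, Finset.mem_coe, Finset.mem_range]
    exact ⟨Nat.div_lt_of_lt_mul (by rw [mul_comm]; exact hi.1), hi.2⟩
  · intro a _ b _ h
    simp only [Prod.mk.injEq] at h
    rw [← Nat.div_add_mod a M, ← Nat.div_add_mod b M, h.1, h.2]

/-! ### A block with a common return property -/

section Block
variable {d : ℕ} {K : Set ℝ} {L : Set (Fin d → ℝ)} {S : ℕ → ℝ → ℝ} {D₁ D₂ γ : ℝ} {N : ℕ}

/-- The construction and the estimates at a fixed scale. The return times are `k M`, `1 ≤ k ≤ q`;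
the parameters close to `c k` return at time `k M`, and `f` restricted to `[k M, (k + 1) M)` is an
`m`-th root of the preimage of `v` under the `k M`-th power of the shift at the parameter `c k`. -/
lemma exists_block_at_scale (hLK : ∀ l ∈ L, ∀ j, l j ∈ K)
    (hD₂ : 0 < D₂) (hγ : 0 < γ)
    (hLip : ∀ n, N ≤ n → ∀ a ∈ K, ∀ b ∈ K, |S n a - S n b| ≤ D₁ * Real.log n * |a - b|)
    (hgrow : ∀ n, N ≤ n → ∀ a ∈ K, D₂ * (n : ℝ) ^ γ ≤ Real.exp (S n a))
    (hosc : ∀ l ∈ L, ∀ l' ∈ L, ∀ j, D₁ * |l j - l' j| ≤ γ / 4)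
    {v : Fin d → ℕ → ℂ} {ℓ : ℕ} (hv : ∀ j i, ℓ ≤ i → v j i = 0) {m : ℕ} (hm : 1 ≤ m)
    {A V η β : ℝ} (hA0 : 0 ≤ A) (hA : ∀ j i, ∀ a ∈ K, ‖v j i‖ * Real.exp (S i a) ≤ A)
    (hV1 : 1 ≤ V) (hV : ∀ j i, ‖v j i‖ ≤ V) (hη0 : 0 ≤ η) (hη1 : η ≤ 1)
    (hβ0 : 0 ≤ β) (hβ1 : β ≤ 1)
    {M q : ℕ} (hMN : N ≤ M) (hMℓ : ℓ < M) (hq : q + 1 ≤ M)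
    (hAβ : A / D₂ * (M : ℝ) ^ (-(γ / 2)) ≤ β ^ m)
    {c : ℕ → Fin d → ℝ} (hc : ∀ k, c k ∈ L)
    (hnet : ∀ l ∈ L, ∃ k, 1 ≤ k ∧ k ≤ q ∧ ∀ j, D₁ * Real.log ((M : ℝ) ^ 2) * |l j - c k j| ≤ η / 2 ∧
      ∀ i, i < ℓ → |S i (l j) - S i (c k j)| ≤ η / 2) :
    ∃ (f : Fin d → ℕ → ℂ) (F : Finset ℕ), F.card ≤ (q + 1) * ℓ ∧
      (∀ j i, i ∉ F → f j i = 0) ∧ (∀ j i, i < M → f j i = 0) ∧ (∀ j i, ‖f j i‖ ≤ β) ∧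
      ∀ l ∈ L, ∃ n, M ≤ n ∧ ∀ j, (∀ i, i ∉ F → f j (i + n) = 0 ∧ v j i = 0) ∧
        ∀ i ∈ F, ∀ k, m ≤ k →
          ‖(Real.exp (S (i + n) (l j) - S i (l j)) : ℂ) * f j (i + n) ^ k
            - (if k = m then v j i else 0)‖ ≤ (if i < ℓ then 2 * V * η else 0) + 3 * V * β := by
  classical
  have hM0 : 0 < M := by omega
  have hM1 : (1 : ℝ) ≤ M := by exact_mod_cast hM0
  have hMpos : (0 : ℝ) < M := by linarith
  have hcK : ∀ k j, c k j ∈ K := fun k j => hLK _ (hc k) j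
  have hmne : m ≠ 0 := by omega
  have hroot : ∀ j i, ∃ z : ℂ, z ^ m
      = v j (i % M) * (Real.exp (S (i % M) (c (i / M) j) - S i (c (i / M) j)) : ℂ) :=
    fun j i => ⟨_, Complex.cpow_nat_inv_pow _ hmne⟩
  choose z hz using hroot
  set f : Fin d → ℕ → ℂ := fun j i => if M ≤ i ∧ i < (q + 1) * M then z j i else 0 with hf
  set F := (Finset.range ((q + 1) * M)).filter fun i => i % M < ℓ with hF
  -- decay of `1 / W_i` along the support of `f`
  have hinv : ∀ i, M ≤ i → ∀ a ∈ K, Real.exp (-S i a) ≤ (M : ℝ) ^ (-γ) / D₂ := by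
    intro i hi a ha
    have h1 := hgrow i (hMN.trans hi) a ha
    have h2 : (M : ℝ) ^ γ ≤ (i : ℝ) ^ γ :=
      Real.rpow_le_rpow hMpos.le (by exact_mod_cast hi) hγ.le
    have h3 : D₂ * (M : ℝ) ^ γ ≤ Real.exp (S i a) := le_trans (by gcongr) h1
    rw [Real.exp_neg, Real.rpow_neg hMpos.le, ← one_div, ← one_div, div_div]
    exact one_div_le_one_div_of_le (by positivity) (by rwa [mul_comm])
  have hβm : A * ((M : ℝ) ^ (-γ) / D₂ * (M : ℝ) ^ (γ / 2)) ≤ β ^ m := by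
    refine le_trans (le_of_eq ?_) hAβ
    rw [show -(γ / 2) = -γ + γ / 2 by ring, Real.rpow_add hMpos]
    ring
  have hone : 1 ≤ (M : ℝ) ^ (γ / 2) := Real.one_le_rpow hM1 (by positivity)
  have hfz : ∀ j i, M ≤ i → i < (q + 1) * M → ‖f j i‖ ^ m
      = ‖v j (i % M)‖ * Real.exp (S (i % M) (c (i / M) j) - S i (c (i / M) j)) := by
    intro j i h1 h2
    rw [hf]
    dsimp only
    rw [if_pos ⟨h1, h2⟩, ← norm_pow, hz, norm_mul, Complex.norm_real, Real.norm_eq_abs,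
      abs_of_pos (Real.exp_pos _)]
  have hfout : ∀ j i, ¬ (M ≤ i ∧ i < (q + 1) * M) → f j i = 0 := fun j i h => if_neg h
  have hfmod : ∀ j i, ℓ ≤ i % M → f j i = 0 := by
    intro j i h
    by_cases hi : M ≤ i ∧ i < (q + 1) * M
    · have := hfz j i hi.1 hi.2
      rw [hv j _ h, norm_zero, zero_mul] at this
      exact norm_eq_zero.1 (pow_eq_zero_iff hmne |>.1 this)
    · exact hfout j i hi
  have hfβ : ∀ j i, ‖f j i‖ ≤ β := by
    intro j i
    by_cases hi : M ≤ i ∧ i < (q + 1) * M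
    · refine (pow_le_pow_iff_left₀ (norm_nonneg _) hβ0 hmne).1 ?_
      rw [hfz j i hi.1 hi.2, sub_eq_add_neg, Real.exp_add, ← mul_assoc]
      refine le_trans ?_ hβm
      have h1 := hinv i hi.1 _ (hcK (i / M) j)
      calc _ ≤ A * ((M : ℝ) ^ (-γ) / D₂) := by
            gcongr
            exact hA j _ _ (hcK _ j)
        _ ≤ A * ((M : ℝ) ^ (-γ) / D₂ * (M : ℝ) ^ (γ / 2)) := by
            gcongr
            exact le_mul_of_one_le_right (by positivity) hone
    · rw [hfout j i hi, norm_zero]; exact hβ0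
  refine ⟨f, F, card_filter_mod_lt q M ℓ, ?_, ?_, hfβ, ?_⟩
  · intro j i hi
    by_cases h : i < (q + 1) * M
    · refine hfmod j i (not_lt.1 fun h' => hi ?_)
      simp [hF, h, h']
    · exact hfout j i (by tauto)
  · intro j i hi
    exact hfout j i (by omega)
  intro l hl
  obtain ⟨k₀, hk1, hkq, hk⟩ := hnet l hl
  refine ⟨k₀ * M, Nat.le_mul_of_pos_left M (by omega), fun j => ⟨fun i hi => ?_, ?_⟩⟩
  · by_cases h : i < (q + 1) * M
    · have h' : ℓ ≤ i % M := not_lt.1 fun h' => hi (by simp [hF, h, h'])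
      exact ⟨hfmod j _ (by rwa [Nat.add_mul_mod_self_right]), hv j i (h'.trans (Nat.mod_le _ _))⟩
    · have : M ≤ (q + 1) * M := Nat.le_mul_of_pos_left M (by omega)
      exact ⟨hfout j _ (by omega), hv j i (by omega)⟩
  intro i hi k hmk
  have hiF : i < (q + 1) * M ∧ i % M < ℓ := by simpa [hF] using hi
  set n := k₀ * M with hn
  have hnM : M ≤ n := Nat.le_mul_of_pos_left M (by omega)
  have hlj := hLK l hl j
  have hkne : k ≠ 0 := by omega
  have h3V : 0 ≤ 3 * V * β := by positivity
  have h2V : 0 ≤ 2 * V * η := by positivity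
  -- Lipschitz control between the current parameter and a net point
  have hLipn : ∀ i', M ≤ i' → i' < (q + 1) * M → ∀ k', |S i' (l j) - S i' (c k' j)|
      ≤ D₁ * |l j - c k' j| * Real.log i' := by
    intro i' h1 _ k'
    refine (hLip i' (hMN.trans h1) _ hlj _ (hcK k' j)).trans (le_of_eq (by ring))
  have hlog : ∀ i', M ≤ i' → i' < (q + 1) * M →
      0 ≤ Real.log i' ∧ Real.log i' ≤ Real.log ((M : ℝ) ^ 2) := by
    intro i' h1 h2
    have hi1 : (1 : ℝ) ≤ i' := by exact_mod_cast hM0.trans_le h1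
    refine ⟨Real.log_nonneg hi1, Real.log_le_log (by linarith) ?_⟩
    have : i' ≤ M ^ 2 := h2.le.trans (by rw [pow_two]; exact Nat.mul_le_mul_right M hq)
    exact_mod_cast this
  by_cases hiM : i < M
  · -- the main terms, where `f` reproduces `v`
    have hiℓ : i < ℓ := by rw [Nat.mod_eq_of_lt hiM] at hiF; exact hiF.2
    rw [if_pos hiℓ]
    have hmod : (i + n) % M = i := by
      rw [hn, Nat.add_mul_mod_self_right, Nat.mod_eq_of_lt hiM]
    have hdiv : (i + n) / M = k₀ := by
      rw [hn, Nat.add_mul_div_right _ _ hM0, Nat.div_eq_of_lt hiM, zero_add]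
    have hlo : M ≤ i + n := by omega
    have hhi : i + n < (q + 1) * M := by
      have : k₀ * M ≤ q * M := Nat.mul_le_mul_right M hkq
      rw [add_mul, one_mul]; omega
    set θ : ℝ := S (i + n) (l j) - S i (l j) + (S i (c k₀ j) - S (i + n) (c k₀ j)) with hθ
    have hθη : |θ| ≤ η := by
      have h1 : |S (i + n) (l j) - S (i + n) (c k₀ j)| ≤ η / 2 := by
        have hD : 0 ≤ D₁ * |l j - c k₀ j| ∨ D₁ * |l j - c k₀ j| < 0 := le_or_gt _ _
        have e := hLipn _ hlo hhi k₀
        obtain ⟨g0, g1⟩ := hlog _ hlo hhi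
        rcases hD with hD | hD
        · refine e.trans (le_trans (mul_le_mul_of_nonneg_left g1 hD) ?_)
          exact le_trans (le_of_eq (by ring)) (hk j).1
        · exact e.trans ((mul_nonpos_of_nonpos_of_nonneg hD.le g0).trans (by positivity))
      have h2 := (hk j).2 i hiℓ
      rw [abs_le] at *
      constructor <;> rw [hθ] <;> linarith [h1.1, h1.2, h2.1, h2.2]
    have hmain : (Real.exp (S (i + n) (l j) - S i (l j)) : ℂ) * f j (i + n) ^ m
        = v j i * (Real.exp θ : ℂ) := by
      rw [hf]
      dsimp only
      rw [if_pos ⟨hlo, hhi⟩, hz, hmod, hdiv, hθ, Real.exp_add]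
      push_cast
      ring
    have hexp : |Real.exp θ - 1| ≤ 2 * η :=
      (Real.abs_exp_sub_one_le (hθη.trans hη1)).trans (by linarith)
    by_cases hkm : k = m
    · subst hkm
      rw [if_pos rfl, hmain, show v j i * (Real.exp θ : ℂ) - v j i
        = v j i * ((Real.exp θ - 1 : ℝ) : ℂ) by push_cast; ring, norm_mul, Complex.norm_real,
        Real.norm_eq_abs]
      calc ‖v j i‖ * |Real.exp θ - 1| ≤ V * (2 * η) :=
            mul_le_mul (hV j i) hexp (abs_nonneg _) (by linarith)
        _ ≤ 2 * V * η + 3 * V * β := by linarith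
    · rw [if_neg hkm, sub_zero]
      obtain ⟨s, rfl⟩ : ∃ s, k = m + (s + 1) := ⟨k - m - 1, by omega⟩
      rw [pow_add, ← mul_assoc, hmain, norm_mul, norm_mul, Complex.norm_real, Real.norm_eq_abs,
        abs_of_pos (Real.exp_pos _), norm_pow]
      have h1 : Real.exp θ ≤ 3 := by linarith [(abs_le.1 hexp).2]
      have h2 : ‖f j (i + n)‖ ^ (s + 1) ≤ β :=
        (pow_le_pow_left₀ (norm_nonneg _) (hfβ j _) _).trans
          (pow_le_of_le_one hβ0 hβ1 (by omega))
      calc ‖v j i‖ * Real.exp θ * ‖f j (i + n)‖ ^ (s + 1) ≤ V * 3 * β := by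
            gcongr
            exact hV j i
        _ ≤ 2 * V * η + 3 * V * β := by linarith
  · -- the terms coming from later return times
    have hMi : M ≤ i := not_lt.1 hiM
    rw [if_neg (by omega : ¬ i < ℓ), zero_add, hv j i (by omega), ite_self, sub_zero]
    by_cases hhi : i + n < (q + 1) * M
    · have hlo : M ≤ i + n := by omega
      set k' := (i + n) / M with hk'
      rw [norm_mul, Complex.norm_real, Real.norm_eq_abs, abs_of_pos (Real.exp_pos _), norm_pow]
      have hpow : ‖f j (i + n)‖ ^ k ≤ ‖f j (i + n)‖ ^ m :=
        pow_le_pow_of_le_one (norm_nonneg _) ((hfβ j _).trans hβ1) hmk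
      have hdiff : S (i + n) (l j) - S (i + n) (c k' j) ≤ Real.log (M : ℝ) * (γ / 2) := by
        refine (le_abs_self _).trans ((hLipn _ hlo hhi k').trans ?_)
        obtain ⟨g0, g1⟩ := hlog _ hlo hhi
        rw [Real.log_pow] at g1
        push_cast at g1
        calc _ ≤ γ / 4 * Real.log ((i + n : ℕ) : ℝ) :=
              mul_le_mul_of_nonneg_right (hosc l hl _ (hc k') j) g0
          _ ≤ γ / 4 * (2 * Real.log M) := by gcongr; exact_mod_cast g1
          _ = _ := by ring
      have hdiff' : Real.exp (S (i + n) (l j) - S (i + n) (c k' j)) ≤ (M : ℝ) ^ (γ / 2) := by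
        rw [Real.rpow_def_of_pos hMpos]
        exact Real.exp_le_exp.2 hdiff
      calc Real.exp (S (i + n) (l j) - S i (l j)) * ‖f j (i + n)‖ ^ k
          ≤ Real.exp (S (i + n) (l j) - S i (l j)) * ‖f j (i + n)‖ ^ m := by gcongr
        _ = ‖v j ((i + n) % M)‖ * Real.exp (S ((i + n) % M) (c k' j))
            * (Real.exp (-S i (l j)) * Real.exp (S (i + n) (l j) - S (i + n) (c k' j))) := by
          rw [hfz j _ hlo hhi, ← Real.exp_add, mul_assoc, ← Real.exp_add, mul_left_comm,
            ← Real.exp_add]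
          congr 2
          ring
        _ ≤ A * ((M : ℝ) ^ (-γ) / D₂ * (M : ℝ) ^ (γ / 2)) :=
          mul_le_mul (hA j _ _ (hcK _ j)) (mul_le_mul (hinv i hMi _ hlj) hdiff' (Real.exp_pos _).le
            (by positivity)) (by positivity) hA0
        _ ≤ β ^ m := hβm
        _ ≤ β := pow_le_of_le_one hβ0 hβ1 hmne
        _ ≤ 3 * V * β := by nlinarith
    · rw [hfout j _ (by tauto), zero_pow hkne, mul_zero, norm_zero]
      exact h3V

/-- For every target `v` there is a small finitely supported `f`, supported far away, whose powers
`f ^ k`, `k ≥ m`, are all sent by a common iterate of the shift at the parameter `l` close to `v`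
if `k = m` and close to `0` if `k > m`; the iterate depends on `l ∈ L`, but `f` does not. -/
lemma exists_common_block (hne : L.Nonempty) (hLb : Bornology.IsBounded L) (hK : IsCompact K)
    (hLK : ∀ l ∈ L, ∀ j, l j ∈ K) (hS : ∀ n, ContinuousOn (S n) K)
    (hD₁ : 0 < D₁) (hD₂ : 0 < D₂) (hγ : 0 < γ)
    (hLip : ∀ n, N ≤ n → ∀ a ∈ K, ∀ b ∈ K, |S n a - S n b| ≤ D₁ * Real.log n * |a - b|)
    (hgrow : ∀ n, N ≤ n → ∀ a ∈ K, D₂ * (n : ℝ) ^ γ ≤ Real.exp (S n a))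
    (hosc : ∀ l ∈ L, ∀ l' ∈ L, ∀ j, D₁ * |l j - l' j| ≤ γ / 4)
    {v : Fin d → ℕ → ℂ} {ℓ : ℕ} (hv : ∀ j i, ℓ ≤ i → v j i = 0) {m : ℕ} (hm : 1 ≤ m)
    {ε : ℝ} (hε : 0 < ε) :
    ∃ (f : Fin d → ℕ → ℂ) (F : Finset ℕ),
      (∀ j i, i ∉ F → f j i = 0) ∧ (∀ j i, i < ℓ → f j i = 0) ∧
      (∀ j, ∑ i ∈ F, ‖f j i‖ ≤ ε) ∧
      ∀ l ∈ L, ∃ n, 1 ≤ n ∧ ℓ ≤ n ∧ ∀ j, (∀ i, i ∉ F → f j (i + n) = 0 ∧ v j i = 0) ∧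
        ∀ k, m ≤ k → ∑ i ∈ F, ‖(Real.exp (S (i + n) (l j) - S i (l j)) : ℂ) * f j (i + n) ^ k
            - (if k = m then v j i else 0)‖ ≤ ε := by
  classical
  -- bounds on the target
  have hbd : ∀ i, ∃ C, ∀ a ∈ K, S i a ≤ C := by
    intro i
    obtain ⟨C, hC⟩ := hK.exists_bound_of_continuousOn (hS i)
    exact ⟨C, fun a ha => (le_abs_self _).trans (hC a ha)⟩
  choose C hC using hbd
  set A : ℝ := ∑ j, ∑ i ∈ Finset.range ℓ, ‖v j i‖ * Real.exp (C i) with hAdef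
  set V : ℝ := 1 + ∑ j, ∑ i ∈ Finset.range ℓ, ‖v j i‖ with hVdef
  have hsum : ∀ g : Fin d → ℕ → ℝ, (∀ j i, 0 ≤ g j i) → ∀ j, ∀ i < ℓ,
      g j i ≤ ∑ j, ∑ i ∈ Finset.range ℓ, g j i := by
    intro g hg j i hi
    refine (Finset.single_le_sum (f := fun i => g j i) (fun i _ => hg j i)
      (Finset.mem_range.2 hi)).trans ?_
    exact Finset.single_le_sum (f := fun j => ∑ i ∈ Finset.range ℓ, g j i)
      (fun j _ => Finset.sum_nonneg fun i _ => hg j i) (Finset.mem_univ j)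
  have hA0 : 0 ≤ A := Finset.sum_nonneg fun j _ => Finset.sum_nonneg fun i _ => by positivity
  have hV1 : 1 ≤ V := by
    rw [hVdef]
    linarith [show 0 ≤ ∑ j, ∑ i ∈ Finset.range ℓ, ‖v j i‖ from
      Finset.sum_nonneg fun j _ => Finset.sum_nonneg fun i _ => norm_nonneg _]
  have hA : ∀ j i, ∀ a ∈ K, ‖v j i‖ * Real.exp (S i a) ≤ A := by
    intro j i a ha
    by_cases hi : i < ℓ
    · refine le_trans ?_ (hsum (fun j i => ‖v j i‖ * Real.exp (C i)) (fun j i => by positivity)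
        j i hi)
      gcongr
      exact hC i a ha
    · rw [hv j i (not_lt.1 hi), norm_zero, zero_mul]
      exact hA0
  have hV : ∀ j i, ‖v j i‖ ≤ V := by
    intro j i
    by_cases hi : i < ℓ
    · have := hsum (fun j i => ‖v j i‖) (fun j i => by positivity) j i hi
      linarith
    · rw [hv j i (not_lt.1 hi), norm_zero]
      linarith
  have hV0 : 0 < V := by linarith
  set η : ℝ := min 1 (ε / (4 * V * (ℓ + 1))) with hηdef
  have hη0 : 0 < η := lt_min one_pos (by positivity)
  have hη1 : η ≤ 1 := min_le_left _ _
  have hηε : (ℓ : ℝ) * (2 * V * η) ≤ ε / 2 := by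
    have h1 : η ≤ ε / (4 * V * (ℓ + 1)) := min_le_right _ _
    rw [le_div_iff₀ (by positivity)] at h1
    nlinarith [mul_pos hV0 hη0]
  obtain ⟨R, hR, hnet⟩ := exists_net hne hLb
  obtain ⟨B, hB⟩ := exists_nat_gt (4 * D₁ * R / η)
  have hB0 : (0 : ℝ) < B := lt_of_le_of_lt (by positivity) hB
  have hBpos : 0 < B := by exact_mod_cast hB0
  rw [div_lt_iff₀ hη0] at hB
  -- uniform continuity of the finitely many `S i`, `i < ℓ`, at the scale of the net
  have hRt : Filter.Tendsto (fun t : ℕ => R / ((B * t : ℕ) : ℝ)) Filter.atTop (nhds 0) := by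
    refine tendsto_const_nhds.div_atTop (tendsto_natCast_atTop_atTop.comp ?_)
    exact Filter.tendsto_id.const_mul_atTop' hBpos
  have hunif : ∀ᶠ t : ℕ in Filter.atTop, ∀ i ∈ Finset.range ℓ, ∀ a ∈ K, ∀ b ∈ K,
      |a - b| ≤ R / ((B * t : ℕ) : ℝ) → |S i a - S i b| ≤ η / 2 := by
    rw [Filter.eventually_all_finset]
    intro i _
    obtain ⟨δ, hδ, h⟩ := Metric.uniformContinuousOn_iff.1
      (hK.uniformContinuousOn_of_continuous (hS i)) (η / 2) (half_pos hη0)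
    filter_upwards [hRt.eventually_lt_const hδ] with t ht a ha b hb hab
    exact (h a ha b hb (hab.trans_lt ht)).le
  have htwo : Filter.Tendsto (fun t : ℕ => 2 ^ t) Filter.atTop Filter.atTop :=
    tendsto_pow_atTop_atTop_of_one_lt one_lt_two
  obtain ⟨t, ⟨β, hβ0, hβ1, hqβ, hAβ⟩, hq, hu, ht1, htN, htℓ⟩ :=
    ((eventually_exists_small (A / D₂) (γ / 2) (half_pos hγ) m hm d B
      (ε := ε / (6 * V * (ℓ + 1))) (by positivity)).and
      ((eventually_pow_add_one_le_two_pow d B).and (hunif.and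
      ((Filter.eventually_ge_atTop 1).and ((htwo.eventually_ge_atTop N).and
      (htwo.eventually_gt_atTop ℓ)))))).exists
  have ht0 : (0 : ℝ) < t := by exact_mod_cast ht1
  obtain ⟨c, hcL, hc⟩ := hnet (B * t) (Nat.mul_pos hBpos ht1)
  obtain ⟨f, F, hcard, hfF, hfM, hfβ, hmain⟩ := exists_block_at_scale hLK hD₂ hγ hLip hgrow hosc hv
    hm hA0 hA hV1 hV hη0.le hη1 hβ0 hβ1 htN htℓ hq hAβ hcL (by
      intro l hl
      obtain ⟨k, hk1, hkq, hk⟩ := hc l hl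
      refine ⟨k, hk1, hkq, fun j => ⟨?_, fun i hi =>
        hu i (Finset.mem_range.2 hi) _ (hLK l hl j) _ (hLK _ (hcL k) j) (hk j)⟩⟩
      have hlog : Real.log (((2 ^ t : ℕ) : ℝ) ^ 2) ≤ 2 * t := by
        push_cast
        rw [← pow_mul, Real.log_pow]
        push_cast
        have := Real.log_two_lt_d9
        nlinarith
      calc D₁ * Real.log (((2 ^ t : ℕ) : ℝ) ^ 2) * |l j - c k j|
          ≤ D₁ * (2 * t) * (R / ((B * t : ℕ) : ℝ)) := by
            gcongr
            exact hk j
        _ = 2 * D₁ * R / B := by push_cast; field_simp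
        _ ≤ η / 2 := by rw [div_le_iff₀ hB0]; linarith)
  have hcardR : (F.card : ℝ) ≤ (((B * t) ^ d + 1 : ℕ) : ℝ) * ℓ := by exact_mod_cast hcard
  have hcβ : (F.card : ℝ) * (3 * V * β) ≤ ε / 2 := by
    rw [le_div_iff₀ (by positivity)] at hqβ
    calc (F.card : ℝ) * (3 * V * β) ≤ (((B * t) ^ d + 1 : ℕ) : ℝ) * (ℓ + 1) * (3 * V * β) := by
          gcongr
          exact hcardR.trans (mul_le_mul_of_nonneg_left (by linarith) (Nat.cast_nonneg _))
      _ = (((B * t) ^ d + 1 : ℕ) : ℝ) * β * (6 * V * (ℓ + 1)) / 2 := by ring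
      _ ≤ ε / 2 := by linarith
  refine ⟨f, F, hfF, fun j i hi => hfM j i (hi.trans htℓ), fun j => ?_, fun l hl => ?_⟩
  · refine (Finset.sum_le_card_nsmul F _ β fun i _ => hfβ j i).trans ?_
    rw [nsmul_eq_mul]
    have : (F.card : ℝ) * β ≤ F.card * (3 * V * β) := by
      gcongr
      nlinarith
    linarith
  · obtain ⟨n, hMn, hn⟩ := hmain l hl
    refine ⟨n, Nat.one_le_two_pow.trans hMn, htℓ.le.trans hMn, fun j => ⟨(hn j).1, fun k hk => ?_⟩⟩
    refine (Finset.sum_le_sum fun i hi => (hn j).2 i hi k hk).trans ?_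
    rw [Finset.sum_add_distrib, Finset.sum_const, nsmul_eq_mul, ← Finset.sum_filter,
      Finset.sum_const, nsmul_eq_mul]
    have hcard' : ((F.filter (· < ℓ)).card : ℝ) ≤ ℓ := by
      have : (F.filter (· < ℓ)).card ≤ (Finset.range ℓ).card :=
        Finset.card_le_card fun i hi => Finset.mem_range.2 (Finset.mem_filter.1 hi).2
      rw [Finset.card_range] at this
      exact_mod_cast this
    have : ((F.filter (· < ℓ)).card : ℝ) * (2 * V * η) ≤ ℓ * (2 * V * η) := by gcongr
    linarith

end Block

/-! ### Iterates, products and powers -/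

/-- `∑_{i ≤ n} log w_i(a)`, the logarithm of `w_1(a) ⋯ w_n(a)`. -/
noncomputable def logWeightSum (w : ℝ → ℕ → ℝ) (n : ℕ) (a : ℝ) : ℝ :=
  ∑ i ∈ Finset.Icc 1 n, Real.log (w a i)

section
variable {X : Type*} [NormedAddCommGroup X] [NormedSpace ℂ X] {ι : X →ₗ[ℂ] (ℕ → ℂ)}

/-- The iterates of a product of weighted shifts in coordinates. -/
lemma apply_prodShift_iterate {d : ℕ} {w : ℝ → ℕ → ℝ} {l : Fin d → ℝ}
    (h : ∀ j, Admissible ι (w (l j))) (n : ℕ) (x : Fin d → X) (j : Fin d) (i : ℕ) :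
    ι ((prodShift ι w l)^[n] x j) i
      = (Real.exp (logWeightSum w (i + n) (l j) - logWeightSum w i (l j)) : ℂ) * ι (x j) (i + n) := by
  induction n generalizing i with
  | zero => simp
  | succ n ih =>
    rw [Function.iterate_succ_apply', prodShift, apply_shift (h j).maps, seqShift, ih, ← mul_assoc,
      show i + 1 + n = i + (n + 1) by ring]
    congr 1
    have h1 : logWeightSum w (i + 1) (l j)
        = logWeightSum w i (l j) + Real.log (w (l j) (i + 1)) := by
      rw [logWeightSum, Finset.sum_Icc_succ_top (by omega), logWeightSum]
    rw [← Complex.ofReal_mul, h1]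
    congr 1
    nth_rw 1 [← Real.exp_log ((h j).pos (i + 1) (by omega))]
    rw [← Real.exp_add]
    congr 1
    ring

namespace IsSolidSeqSpace

lemma exists_of_finite_support (H : IsSolidSeqSpace ι) (F : Finset ℕ) (f : ℕ → ℂ)
    (hf : ∀ i, i ∉ F → f i = 0) : ∃ y : X, ι y = f ∧ ‖y‖ ≤ ∑ i ∈ F, ‖f i‖ := by
  classical
  choose e he hn using H.exists_single
  refine ⟨∑ i ∈ F, f i • e i, ?_, ?_⟩
  · funext n
    simp only [map_sum, map_smul, he, Finset.sum_apply, Pi.smul_apply, smul_eq_mul, Pi.single_apply,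
      mul_ite, mul_one, mul_zero]
    rw [Finset.sum_ite_eq]
    split_ifs with h
    · rfl
    · exact (hf n h).symm
  · refine (norm_sum_le _ _).trans (Finset.sum_le_sum fun i _ => ?_)
    rw [norm_smul]
    exact mul_le_of_le_one_right (norm_nonneg _) (hn i)

lemma norm_le_sum (H : IsSolidSeqSpace ι) {F : Finset ℕ} {y : X}
    (hy : ∀ i, i ∉ F → ι y i = 0) : ‖y‖ ≤ ∑ i ∈ F, ‖ι y i‖ := by
  obtain ⟨z, hz, hn⟩ := H.exists_of_finite_support F (ι y) hy
  rwa [H.injective hz] at hn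

/-- The coordinatewise product as a continuous bilinear map. -/
lemma exists_mul (H : IsSolidSeqSpace ι) :
    ∃ μ : X →L[ℂ] X →L[ℂ] X, ∀ x y n, ι (μ x y) n = ι x n * ι y n := by
  have h : ∀ x y : X, ∃ z : X, ι z = (fun n => ι x n * ι y n) ∧ ‖z‖ ≤ ‖x‖ * ‖y‖ := fun x y =>
    H.exists_of_dominated y _ id ‖x‖ Function.injective_id (norm_nonneg _) fun n => by
      rw [norm_mul]
      exact mul_le_mul_of_nonneg_right (H.norm_coord_le x n) (norm_nonneg _)
  choose μ hμ hn using h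
  refine ⟨LinearMap.mkContinuous₂ (LinearMap.mk₂ ℂ μ ?_ ?_ ?_ ?_) 1 fun x y => ?_,
    fun x y n => congrFun (hμ x y) n⟩
  · intro x x' y
    apply H.injective
    simp only [hμ, map_add]
    funext n
    simp [add_mul]
  · intro a x y
    apply H.injective
    simp only [hμ, map_smul]
    funext n
    simp [mul_assoc]
  · intro x y y'
    apply H.injective
    simp only [hμ, map_add]
    funext n
    simp [mul_add]
  · intro a x y
    apply H.injective
    simp only [hμ, map_smul]
    funext n
    simp [mul_left_comm]
  · rw [one_mul]
    exact hn x y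

/-- The coordinatewise powers `x ↦ x ^ (k + 1)` as continuous maps. -/
lemma exists_pow (H : IsSolidSeqSpace ι) :
    ∃ P : ℕ → X → X, (∀ k, Continuous (P k)) ∧ ∀ k x n, ι (P k x) n = ι x n ^ (k + 1) := by
  obtain ⟨μ, hμ⟩ := H.exists_mul
  have h : ∀ k, ∃ P : X → X, Continuous P ∧ ∀ x n, ι (P x) n = ι x n ^ (k + 1) := by
    intro k
    induction k with
    | zero => exact ⟨id, continuous_id, fun x n => by simp⟩
    | succ k ih =>
      obtain ⟨P, hP, hPk⟩ := ih
      refine ⟨fun x => μ (P x) x, by fun_prop, fun x n => ?_⟩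
      rw [hμ, hPk, pow_succ _ (k + 1)]
  choose P hP hPk using h
  exact ⟨P, hP, hPk⟩

lemma separableSpace (H : IsSolidSeqSpace ι) : TopologicalSpace.SeparableSpace X := by
  choose e he hn using H.exists_single
  have hs : TopologicalSpace.IsSeparable (closure (Submodule.span ℂ (Set.range e) : Set X)) :=
    ((Set.countable_range e).isSeparable.span).closure
  rw [← TopologicalSpace.isSeparable_univ_iff]
  refine hs.mono fun x _ => Metric.mem_closure_iff.2 fun ε hε => ?_
  obtain ⟨y, ⟨M, hM⟩, hy⟩ := H.exists_approx x ε hε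
  refine ⟨y, ?_, by rwa [dist_eq_norm]⟩
  have : y = ∑ i ∈ Finset.range M, ι y i • e i := by
    apply H.injective
    funext n
    simp only [map_sum, map_smul, he, Finset.sum_apply, Pi.smul_apply, smul_eq_mul, Pi.single_apply,
      mul_ite, mul_one, mul_zero]
    rw [Finset.sum_ite_eq]
    split_ifs with h
    · rfl
    · exact hM n (not_lt.1 fun h' => h (Finset.mem_range.2 h'))
  rw [this]
  exact Submodule.sum_mem _ fun i _ => Submodule.smul_mem _ _ (Submodule.subset_span ⟨i, rfl⟩)

end IsSolidSeqSpace

/-! ### Open dense sets of vectors -/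

/-- The set of `u ∈ X^d` such that, for every parameter `l ∈ L`, some iterate of the product of the
shifts at `l` sends `P m u` to within `ε` of `v` and `P k u`, `m < k ≤ m + N`, to within `ε` of `0`.
It is used with `P k u = u ^ (k + 1)`. -/
def powerTransitSet {d : ℕ} (ι : X →ₗ[ℂ] (ℕ → ℂ)) (w : ℝ → ℕ → ℝ) (P : ℕ → X → X)
    (L : Set (Fin d → ℝ)) (v : Fin d → X) (m N : ℕ) (ε : ℝ) : Set (Fin d → X) :=
  {u | ∀ l ∈ L, ∃ n, 1 ≤ n ∧ ∀ k ∈ Finset.Icc m (m + N),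
    ‖(prodShift ι w l)^[n] (fun j => P k (u j)) - (if k = m then v else 0)‖ < ε}

lemma continuous_prodShift_iterate {d : ℕ} {I : Set ℝ} {w : ℝ → ℕ → ℝ}
    (hw : IsContinuousFamily ι I w) {L : Set (Fin d → ℝ)} (hL : ∀ l ∈ L, ∀ j, l j ∈ I) (n : ℕ) :
    Continuous fun q : L × (Fin d → X) => (prodShift ι w q.1)^[n] q.2 := by
  induction n with
  | zero => exact continuous_snd
  | succ n ih =>
    simp only [Function.iterate_succ_apply']
    refine continuous_pi fun j => ?_
    have h1 : Continuous fun q : L × (Fin d → X) =>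
        ((q.1 : Fin d → ℝ) j, (prodShift ι w q.1)^[n] q.2 j) :=
      ((continuous_apply j).comp (continuous_subtype_val.comp continuous_fst)).prodMk
        ((continuous_apply j).comp ih)
    exact hw.cont_shift.comp_continuous h1 fun q => ⟨hL _ q.1.2 j, trivial⟩

lemma isOpen_powerTransitSet {d : ℕ} {I : Set ℝ} {w : ℝ → ℕ → ℝ}
    (hw : IsContinuousFamily ι I w) {P : ℕ → X → X} (hP : ∀ k, Continuous (P k))
    {L : Set (Fin d → ℝ)} (hLc : IsCompact L) (hL : ∀ l ∈ L, ∀ j, l j ∈ I) (v : Fin d → X)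
    (m N : ℕ) (ε : ℝ) : IsOpen (powerTransitSet ι w P L v m N ε) := by
  have : CompactSpace L := isCompact_iff_compactSpace.1 hLc
  let O : Set (L × (Fin d → X)) := {q | ∃ n, 1 ≤ n ∧ ∀ k ∈ Finset.Icc m (m + N),
    ‖(prodShift ι w q.1)^[n] (fun j => P k (q.2 j)) - (if k = m then v else 0)‖ < ε}
  have hO : IsOpen O := by
    have : O = ⋃ n ∈ Set.Ici 1, ⋂ k ∈ Finset.Icc m (m + N), {q : L × (Fin d → X) |
        ‖(prodShift ι w q.1)^[n] (fun j => P k (q.2 j)) - (if k = m then v else 0)‖ < ε} := by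
      ext q
      simp [O]
    rw [this]
    refine isOpen_biUnion fun n _ => isOpen_biInter_finset fun k _ => ?_
    refine isOpen_lt ?_ continuous_const
    have h1 : Continuous fun q : L × (Fin d → X) => (q.1, fun j => P k (q.2 j)) := by fun_prop
    exact (((continuous_prodShift_iterate hw hL n).comp h1).sub continuous_const).norm
  have h2 : powerTransitSet ι w P L v m N ε = (Prod.snd '' Oᶜ)ᶜ := by
    ext u
    simp [powerTransitSet, O]
  rw [h2]
  exact (isClosedMap_snd_of_compactSpace _ hO.isClosed_compl).isOpen_compl

/-- `L` is a compact set of parameters in some `K^d`, with `K ⊆ I` compact satisfying the growth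
condition, and is so small that the oscillation of `log (w_1 ⋯ w_n)` on each of its projections is
at most `(γ / 4) log n`. -/
def IsSmallParameterSet {d : ℕ} (I : Set ℝ) (w : ℝ → ℕ → ℝ) (L : Set (Fin d → ℝ)) : Prop :=
  IsCompact L ∧ ∃ K ⊆ I, IsCompact K ∧ (∀ l ∈ L, ∀ j, l j ∈ K) ∧
    ∃ D₁ D₂ γ : ℝ, 0 < D₁ ∧ 0 < D₂ ∧ 0 < γ ∧
      (∀ l ∈ L, ∀ l' ∈ L, ∀ j, D₁ * |l j - l' j| ≤ γ / 4) ∧ ∃ N : ℕ, ∀ n : ℕ, N ≤ n →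
      (∀ a ∈ K, ∀ b ∈ K,
        |logWeightSum w n a - logWeightSum w n b| ≤ D₁ * Real.log n * |a - b|) ∧
      (∀ a ∈ K, D₂ * (n : ℝ) ^ γ ≤ ∏ i ∈ Finset.Icc 1 n, w a i)

/-- The covering sets are the cubes of side `γ / (4 D₁)` of a grid, intersected with `K^d`; here `K`
runs through an exhaustion of `I`, and `γ`, `D₁` depend on `K`. -/
lemma exists_cover_isSmallParameterSet (d : ℕ) {I : Set ℝ} (hI : IsSigmaCompact I)
    {w : ℝ → ℕ → ℝ} (hw : LogLipschitzGrowth I w) :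
    ∃ 𝓛 : ℕ × (Fin d → ℤ) → Set (Fin d → ℝ), (∀ s, IsSmallParameterSet I w (𝓛 s)) ∧
      ∀ l : Fin d → ℝ, (∀ j, l j ∈ I) → ∃ s, l ∈ 𝓛 s := by
  obtain ⟨K₀, hK₀, hKI⟩ := hI
  set K := Set.accumulate K₀ with hKdef
  have hK : ∀ n, IsCompact (K n) := fun n => isCompact_accumulate hK₀ n
  have hKs : ∀ n, K n ⊆ I := fun n => by
    rw [← hKI, ← Set.iUnion_accumulate]
    exact Set.subset_iUnion _ n
  choose D₁ D₂ γ hD₁ hD₂ hγ N hN using fun n => hw (K n) (hKs n) (hK n)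
  have hh : ∀ n, 0 < γ n / (4 * D₁ n) := fun n => div_pos (hγ n) (by linarith [hD₁ n])
  refine ⟨fun s => Set.univ.pi fun j => K s.1 ∩ Set.Icc (γ s.1 / (4 * D₁ s.1) * s.2 j)
    (γ s.1 / (4 * D₁ s.1) * (s.2 j + 1)), fun s => ⟨?_, K s.1, hKs _, hK _, ?_, ?_⟩, ?_⟩
  · exact isCompact_univ_pi fun j => (hK _).inter_right isClosed_Icc
  · exact fun l hl j => (hl j trivial).1
  · refine ⟨D₁ s.1, D₂ s.1, γ s.1, hD₁ _, hD₂ _, hγ _, fun l hl l' hl' j => ?_, N s.1, hN s.1⟩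
    have h1 := (hl j trivial).2
    have h2 := (hl' j trivial).2
    have h3 : |l j - l' j| ≤ γ s.1 / (4 * D₁ s.1) := by
      rw [mul_add, mul_one] at h1 h2
      rw [abs_le]
      constructor <;> linarith [h1.1, h1.2, h2.1, h2.2]
    rw [le_div_iff₀ (by linarith [hD₁ s.1])] at h3
    linarith
  · intro l hl
    have hmem : ∀ j, ∃ n, l j ∈ K₀ n := fun j => Set.mem_iUnion.1 (hKI ▸ hl j)
    choose r hr using hmem
    set n := Finset.univ.sup r
    refine ⟨(n, fun j => ⌊l j / (γ n / (4 * D₁ n))⌋), fun j _ => ⟨?_, ?_, ?_⟩⟩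
    · exact Set.mem_accumulate.2 ⟨r j, Finset.le_sup (Finset.mem_univ j), hr j⟩
    · dsimp only
      rw [mul_comm, ← le_div_iff₀ (hh n)]
      exact Int.floor_le _
    · dsimp only
      rw [mul_comm, ← div_le_iff₀ (hh n)]
      exact (Int.lt_floor_add_one _).le

lemma exp_logWeightSum {w : ℝ → ℕ → ℝ} {a : ℝ} (h : ∀ n, 1 ≤ n → 0 < w a n) (n : ℕ) :
    Real.exp (logWeightSum w n a) = ∏ i ∈ Finset.Icc 1 n, w a i := by
  rw [logWeightSum, Real.exp_sum]
  exact Finset.prod_congr rfl fun i hi => Real.exp_log (h i (Finset.mem_Icc.1 hi).1)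

/-- A vector is first replaced by a finitely supported one, and then perturbed by the block of
`exists_common_block`. The iterates used there annihilate the finitely supported part of every
power. -/
lemma IsSolidSeqSpace.dense_powerTransitSet (H : IsSolidSeqSpace ι) {d : ℕ} {I : Set ℝ}
    {w : ℝ → ℕ → ℝ} (hw : IsContinuousFamily ι I w) {P : ℕ → X → X}
    (hPk : ∀ k x n, ι (P k x) n = ι x n ^ (k + 1))
    {L : Set (Fin d → ℝ)} (hL : IsSmallParameterSet I w L) (v : Fin d → X)
    (m N : ℕ) {ε : ℝ} (hε : 0 < ε) : Dense (powerTransitSet ι w P L v m N ε) := by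
  classical
  obtain ⟨hLc, K, hKI, hK, hLK, D₁, D₂, γ, hD₁, hD₂, hγ, hosc, N₀, hN₀⟩ := hL
  rcases L.eq_empty_or_nonempty with rfl | hne
  · rw [show powerTransitSet ι w P ∅ v m N ε = Set.univ by ext; simp [powerTransitSet]]
    exact dense_univ
  rw [Metric.dense_iff]
  intro u₀ r hr
  have hpos : ∀ a ∈ I, ∀ n, 1 ≤ n → 0 < w a n := fun a ha => (hw.admissible a ha).pos
  have happrox : ∀ (u : Fin d → X) {δ : ℝ}, 0 < δ → ∃ (x : Fin d → X) (ℓ : ℕ),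
      (∀ j i, ℓ ≤ i → ι (x j) i = 0) ∧ ‖x - u‖ ≤ δ := by
    intro u δ hδ
    choose x hx hxu using fun j => H.exists_approx (u j) δ hδ
    choose ℓ hℓ using hx
    refine ⟨x, Finset.univ.sup ℓ, fun j i hi => hℓ j i
      ((Finset.le_sup (Finset.mem_univ j)).trans hi), (pi_norm_le_iff_of_nonneg hδ.le).2 fun j => ?_⟩
    rw [Pi.sub_apply, norm_sub_rev]
    exact (hxu j).le
  obtain ⟨x, ℓ₁, hx, hxu⟩ := happrox u₀ (show 0 < r / 4 by positivity)
  obtain ⟨v', ℓ₂, hv', hvv⟩ := happrox v (show 0 < ε / 4 by positivity)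
  set ℓ := max ℓ₁ ℓ₂
  have hScont : ∀ n, ContinuousOn (logWeightSum w n) K := fun n =>
    continuousOn_finsetSum _ fun i hi =>
      ((hw.cont_weight i (Finset.mem_Icc.1 hi).1).mono hKI).log fun a ha =>
        (hpos a (hKI ha) i (Finset.mem_Icc.1 hi).1).ne'
  obtain ⟨f, F, hfF, hfℓ, hfsum, hmain⟩ := exists_common_block (S := logWeightSum w) (N := N₀)
    (v := fun j => ι (v' j)) (ℓ := ℓ) (m := m + 1) (ε := min (r / 4) (ε / 4))
    hne hLc.isBounded hK hLK hScont hD₁ hD₂ hγ (fun n hn => (hN₀ n hn).1)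
    (fun n hn a ha => by
      rw [exp_logWeightSum (hpos a (hKI ha))]
      exact (hN₀ n hn).2 a ha)
    hosc (fun j i hi => hv' j i ((le_max_right _ _).trans hi)) (by omega) (by positivity)
  choose y hy hyn using fun j => H.exists_of_finite_support F (f j) (hfF j)
  refine ⟨x + y, ?_, fun l hl => ?_⟩
  · have hynorm : ‖y‖ ≤ r / 4 := (pi_norm_le_iff_of_nonneg (by positivity)).2 fun j =>
      (hyn j).trans ((hfsum j).trans (min_le_left _ _))
    rw [mem_ball_iff_norm, show x + y - u₀ = (x - u₀) + y by abel]
    linarith [norm_add_le (x - u₀) y]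
  · obtain ⟨n, hn1, hnℓ, hn⟩ := hmain l hl
    refine ⟨n, hn1, fun k hk => ?_⟩
    have hmk : m ≤ k := (Finset.mem_Icc.1 hk).1
    have hadm : ∀ j, Admissible ι (w (l j)) := fun j => hw.admissible _ (hKI (hLK l hl j))
    set T := (prodShift ι w l)^[n] (fun j => P k ((x + y) j)) with hT
    have hcoord : ∀ j i, ι ((T - (if k = m then v' else 0)) j) i
        = (Real.exp (logWeightSum w (i + n) (l j) - logWeightSum w i (l j)) : ℂ)
            * f j (i + n) ^ (k + 1) - (if k + 1 = m + 1 then ι (v' j) i else 0) := by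
      intro j i
      rw [Pi.sub_apply, map_sub, Pi.sub_apply, hT, apply_prodShift_iterate hadm, hPk, Pi.add_apply,
        map_add, Pi.add_apply, hx j _ (by have := le_max_left ℓ₁ ℓ₂; omega), zero_add, hy]
      congr 1
      by_cases h : k = m <;> simp [h]
    have hclose : ‖T - (if k = m then v' else 0)‖ ≤ ε / 4 := by
      refine (pi_norm_le_iff_of_nonneg (by positivity)).2 fun j => ?_
      refine (H.norm_le_sum (F := F) fun i hi => ?_).trans ?_
      · rw [hcoord, ((hn j).1 i hi).1, ((hn j).1 i hi).2]
        simp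
      · refine le_trans (le_of_eq (Finset.sum_congr rfl fun i _ => by rw [hcoord])) ?_
        exact ((hn j).2 (k + 1) (by omega)).trans (min_le_right _ _)
    have hvv' : ‖(if k = m then v' else 0) - (if k = m then v else 0)‖ ≤ ε / 4 := by
      split_ifs
      · exact hvv
      · rw [sub_zero, norm_zero]; positivity
    calc ‖T - (if k = m then v else 0)‖
        = ‖(T - (if k = m then v' else 0))
            + ((if k = m then v' else 0) - (if k = m then v else 0))‖ := by congr 1; abel
      _ ≤ ε / 4 + ε / 4 := (norm_add_le _ _).trans (add_le_add hclose hvv')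
      _ < ε := by linarith

/-! ### The algebra generated by a generic vector -/

lemma IsSolidSeqSpace.prodShift_iterate_sum_smul (H : IsSolidSeqSpace ι) {d : ℕ} {w : ℝ → ℕ → ℝ}
    {l : Fin d → ℝ} (h : ∀ j, Admissible ι (w (l j))) (n : ℕ) (s : Finset ℕ) (p : ℕ → ℂ)
    (x : ℕ → Fin d → X) : (prodShift ι w l)^[n] (∑ k ∈ s, p k • x k)
      = ∑ k ∈ s, p k • (prodShift ι w l)^[n] (x k) := by
  funext j
  apply H.injective
  funext i
  simp only [apply_prodShift_iterate h, Finset.sum_apply, map_sum, Pi.smul_apply, map_smul,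
    smul_eq_mul, Finset.mul_sum]
  exact Finset.sum_congr rfl fun k _ => by ring

/-- The common hypercyclic algebra, for all spaces `X` with the properties of `IsSolidSeqSpace`. -/
theorem IsSolidSeqSpace.hasCommonHypercyclicAlgebra [CompleteSpace X] (H : IsSolidSeqSpace ι)
    {d : ℕ} (hd : 1 ≤ d) {I : Set ℝ} (hI : IsSigmaCompact I) {w : ℝ → ℕ → ℝ}
    (hg : LogLipschitzGrowth I w) (hw : IsContinuousFamily ι I w) :
    HasCommonHypercyclicAlgebra ι d I w := by
  classical
  obtain ⟨μ, hμ⟩ := H.exists_mul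
  obtain ⟨P, hP, hPk⟩ := H.exists_pow
  obtain ⟨𝓛, h𝓛, hcov⟩ := exists_cover_isSmallParameterSet d hI hg
  have := H.separableSpace
  have : Nonempty (Fin d) := ⟨⟨0, hd⟩⟩
  have : Nontrivial X := by
    obtain ⟨e, he, -⟩ := H.exists_single 0
    refine ⟨e, 0, fun h => ?_⟩
    rw [h, map_zero] at he
    simpa using congrFun he 0
  have hLI : ∀ s, ∀ l ∈ 𝓛 s, ∀ j, l j ∈ I := by
    intro s l hl j
    obtain ⟨-, K, hKI, -, hLK, -⟩ := h𝓛 s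
    exact hKI (hLK l hl j)
  let ν := TopologicalSpace.denseSeq (Fin d → X)
  -- Baire: a nonzero `u` belonging to all the sets `powerTransitSet`
  have hdense := dense_iInter_of_isOpen
    (f := fun s : (ℕ × (Fin d → ℤ)) × ℕ × ℕ × ℕ =>
      powerTransitSet ι w P (𝓛 s.1) (ν s.2.1) s.2.2.1 s.2.2.2 (1 / ((s.2.2.2 : ℝ) + 1)))
    (fun s => isOpen_powerTransitSet hw hP (h𝓛 s.1).1 (hLI s.1) _ _ _ _)
    (fun s => H.dense_powerTransitSet hw hPk (h𝓛 s.1) _ _ _ (by positivity))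
  obtain ⟨u, hu0, hu⟩ := hdense.inter_open_nonempty {0}ᶜ isOpen_compl_singleton
    (exists_ne (0 : Fin d → X))
  rw [Set.mem_iInter] at hu
  set U : ℕ → Fin d → X := fun k j => P k (u j) with hU
  have hU0 : U 0 = u := funext fun j => H.injective (funext fun n => by rw [hU, hPk]; simp)
  refine ⟨Submodule.span ℂ (Set.range U), ?_, ?_, ?_⟩
  · have hmul : ∀ x ∈ Submodule.span ℂ (Set.range U), ∀ y ∈ Submodule.span ℂ (Set.range U),
        (fun j => μ (x j) (y j)) ∈ Submodule.span ℂ (Set.range U) := by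
      intro x hx y hy
      induction hx, hy using Submodule.span_induction₂ with
      | mem_mem x y hx hy =>
        obtain ⟨a, rfl⟩ := hx
        obtain ⟨b, rfl⟩ := hy
        refine Submodule.subset_span ⟨a + b + 1, funext fun j => H.injective (funext fun n => ?_)⟩
        rw [hU, hμ, hPk, hPk, hPk]
        ring
      | zero_left y _ =>
        convert Submodule.zero_mem (Submodule.span ℂ (Set.range U)) using 1
        funext j
        simp
      | zero_right x _ =>
        convert Submodule.zero_mem (Submodule.span ℂ (Set.range U)) using 1
        funext j
        simp
      | add_left x x' y _ _ _ h h' =>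
        convert Submodule.add_mem _ h h' using 1
        funext j
        simp
      | add_right x y y' _ _ _ h h' =>
        convert Submodule.add_mem _ h h' using 1
        funext j
        simp
      | smul_left r x y _ _ h =>
        convert Submodule.smul_mem _ r h using 1
        funext j
        simp
      | smul_right r x y _ _ h =>
        convert Submodule.smul_mem _ r h using 1
        funext j
        simp
    exact fun x hx y hy => ⟨_, hmul x hx y hy, fun j n => hμ _ _ _⟩
  · rw [Submodule.ne_bot_iff]
    exact ⟨u, Submodule.subset_span ⟨0, hU0⟩, hu0⟩
  intro x hx hx0 l hl
  obtain ⟨p, hp⟩ := Finsupp.mem_span_range_iff_exists_finsupp.1 hx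
  have hpne : p.support.Nonempty := by
    rw [Finsupp.support_nonempty_iff]
    rintro rfl
    exact hx0 (by simpa using hp.symm)
  set m := p.support.min' hpne with hm
  have hmp : m ∈ p.support := Finset.min'_mem _ _
  have hpm : p m ≠ 0 := Finsupp.mem_support_iff.1 hmp
  obtain ⟨s, hs⟩ := hcov l hl
  rw [IsHypercyclicVector, Metric.dense_iff]
  intro y r hr
  obtain ⟨b, hb⟩ := (TopologicalSpace.denseRange_denseSeq (Fin d → X)).exists_dist_lt
    ((p m)⁻¹ • y) (show 0 < r / (2 * ‖p m‖) by positivity)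
  set σ : ℝ := ∑ k ∈ p.support, ‖p k‖ with hσ
  obtain ⟨N₁, hN₁⟩ := exists_nat_gt (2 * σ / r)
  set N := max N₁ (p.support.sup id) with hN
  obtain ⟨n, hn1, hn⟩ := hu (s, b, m, N) l hs
  refine ⟨(prodShift ι w l)^[n] x, ?_, n, hn1, rfl⟩
  have hTx : (prodShift ι w l)^[n] x = ∑ k ∈ p.support, p k • (prodShift ι w l)^[n] (U k) := by
    rw [← hp, Finsupp.sum]
    exact H.prodShift_iterate_sum_smul (fun j => hw.admissible _ (hl j)) n _ _ _
  have hdiff : (prodShift ι w l)^[n] x - y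
      = ∑ k ∈ p.support, p k • ((prodShift ι w l)^[n] (U k) - (if k = m then ν b else 0))
        + p m • (ν b - (p m)⁻¹ • y) := by
    simp only [smul_sub, Finset.sum_sub_distrib, smul_ite, smul_zero]
    rw [Finset.sum_ite_eq', if_pos hmp, smul_smul, mul_inv_cancel₀ hpm, one_smul, hTx]
    abel
  have hNpos : (0 : ℝ) < (N : ℝ) + 1 := by positivity
  have h1 : ‖∑ k ∈ p.support, p k • ((prodShift ι w l)^[n] (U k) - (if k = m then ν b else 0))‖
      ≤ σ * (1 / ((N : ℝ) + 1)) := by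
    rw [hσ, Finset.sum_mul]
    refine (norm_sum_le _ _).trans (Finset.sum_le_sum fun k hk => ?_)
    rw [norm_smul]
    refine mul_le_mul_of_nonneg_left (hn k (Finset.mem_Icc.2 ⟨Finset.min'_le _ _ hk, ?_⟩)).le
      (norm_nonneg _)
    have h2 : k ≤ p.support.sup id := Finset.le_sup (f := id) hk
    have h3 : p.support.sup id ≤ N := le_max_right _ _
    exact (h2.trans h3).trans (Nat.le_add_left _ _)
  have h2 : σ * (1 / ((N : ℝ) + 1)) < r / 2 := by
    have h3 : (N₁ : ℝ) ≤ N := by exact_mod_cast le_max_left _ _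
    rw [div_lt_iff₀ hr] at hN₁
    rw [mul_one_div, div_lt_iff₀ hNpos]
    nlinarith
  have h3 : ‖p m • (ν b - (p m)⁻¹ • y)‖ < r / 2 := by
    rw [norm_smul, norm_sub_rev, ← dist_eq_norm]
    calc ‖p m‖ * dist ((p m)⁻¹ • y) (ν b) < ‖p m‖ * (r / (2 * ‖p m‖)) :=
          mul_lt_mul_of_pos_left hb (norm_pos_iff.2 hpm)
      _ = r / 2 := by
          have : ‖p m‖ ≠ 0 := norm_ne_zero_iff.2 hpm
          field_simp
  rw [mem_ball_iff_norm, hdiff]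
  linarith [norm_add_le (∑ k ∈ p.support, p k • ((prodShift ι w l)^[n] (U k)
    - (if k = m then ν b else 0))) (p m • (ν b - (p m)⁻¹ • y))]

end

/-! ### The spaces `ℓ_p` and `c_0` -/

theorem mainTheorem5 (d : ℕ) (hd : 1 ≤ d) :
    (∀ (I : Set ℝ) (w : ℝ → ℕ → ℝ), I ⊆ Set.Ioi 0 → IsSigmaCompact I → LogLipschitzGrowth I w →
      (∀ (p : ℝ≥0∞) [Fact (1 ≤ p)], p ≠ ∞ → IsContinuousFamily (ellPSeq p) I w →
        HasCommonHypercyclicAlgebra (ellPSeq p) d I w) ∧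
      (IsContinuousFamily cZeroSeq I w → HasCommonHypercyclicAlgebra cZeroSeq d I w)) ∧
    (∀ w : ℝ → ℕ → ℝ,
      (w = fun (a : ℝ) (n : ℕ) => 1 + a / (n : ℝ)) ∨ (w = fun (a : ℝ) (n : ℕ) => (1 + 1 / (n : ℝ)) ^ a) →
      LogLipschitzGrowth (Set.Ioi 0) w ∧
      (∀ (p : ℝ≥0∞) [Fact (1 ≤ p)], p ≠ ∞ → IsContinuousFamily (ellPSeq p) (Set.Ioi 0) w ∧
        HasCommonHypercyclicAlgebra (ellPSeq p) d (Set.Ioi 0) w) ∧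
      (IsContinuousFamily cZeroSeq (Set.Ioi 0) w ∧
        HasCommonHypercyclicAlgebra cZeroSeq d (Set.Ioi 0) w)) := by
  refine ⟨fun I w _ hI hg => ⟨fun p _ hp hw =>
    (isSolidSeqSpace_ellPSeq p hp).hasCommonHypercyclicAlgebra hd hI hg hw, fun hw =>
    isSolidSeqSpace_cZeroSeq.hasCommonHypercyclicAlgebra hd hI hg hw⟩, ?_⟩
  have hI : IsSigmaCompact (Set.Ioi (0 : ℝ)) := by
    rw [isSigmaCompact_iff_sigmaCompactSpace]
    have : LocallyCompactSpace (Set.Ioi (0 : ℝ)) := isOpen_Ioi.locallyCompactSpace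
    infer_instance
  have key : ∀ w : ℝ → ℕ → ℝ, LogLipschitzGrowth (Set.Ioi 0) w →
      (∀ (p : ℝ≥0∞) [Fact (1 ≤ p)], p ≠ ∞ → IsContinuousFamily (ellPSeq p) (Set.Ioi 0) w) →
      IsContinuousFamily cZeroSeq (Set.Ioi 0) w →
      LogLipschitzGrowth (Set.Ioi 0) w ∧
      (∀ (p : ℝ≥0∞) [Fact (1 ≤ p)], p ≠ ∞ → IsContinuousFamily (ellPSeq p) (Set.Ioi 0) w ∧
        HasCommonHypercyclicAlgebra (ellPSeq p) d (Set.Ioi 0) w) ∧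
      (IsContinuousFamily cZeroSeq (Set.Ioi 0) w ∧
        HasCommonHypercyclicAlgebra cZeroSeq d (Set.Ioi 0) w) := fun w hg h₁ h₂ =>
    ⟨hg, fun p _ hp => ⟨h₁ p hp,
      (isSolidSeqSpace_ellPSeq p hp).hasCommonHypercyclicAlgebra hd hI hg (h₁ p hp)⟩,
      h₂, isSolidSeqSpace_cZeroSeq.hasCommonHypercyclicAlgebra hd hI hg h₂⟩
  rintro w (rfl | rfl)
  · exact key _ logLipschitzGrowth_one_add_div
      (fun p _ hp => (isSolidSeqSpace_ellPSeq p hp).isContinuousFamily_one_add_div)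
      isSolidSeqSpace_cZeroSeq.isContinuousFamily_one_add_div
  · exact key _ logLipschitzGrowth_one_add_inv_rpow
      (fun p _ hp => (isSolidSeqSpace_ellPSeq p hp).isContinuousFamily_one_add_inv_rpow)
      isSolidSeqSpace_cZeroSeq.isContinuousFamily_one_add_inv_rpow
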